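/- Circuits consist of CNOTs and arbitrary single-qubit gates. A circuit may use ancillas: a clean ancilla starts in $|0\rangle$ and is returned to $|0\rangle$; a dirty ancilla starts in an arbitrary unknown state and is restored. An isometry from $m$ to $n$ qubits is a $2^n\times 2^m$ complex matrix $W$ with $W^\dagger W=I$; it is implemented by a circuit that maps $|0\rangle^{\otimes(n-m)}\otimes|x\rangle$ to $W|x\rangle$ for every $x\in\{0,1\}^m$ (with the ancillas restored). Let $\operatorname{nnz}$ be the number of non-zero entries in the computational basis. For $a,b\ge 0$ let - $\mathcal N_H^{\Delta\Pi}(n,s)$ be the number of CNOTs required, with $a$ clean and $b$ dirty ancillas, to implement the Householder reflection $H_v=I-2|v\rangle\langle v|$ up to a diagonal gate and a permutation gate (that is, to implement $\Delta\Pi H_v$ for some diagonal gate $\Delta$ and some permutation gate $\Pi$ of the computational basis), in the worst case over all $n$-qubit states $v$ with $\operatorname{nnz}(v)\le 2^s$; - $\mathcal N_{\Pi I\Delta}(n,m)$ be the number of CNOTs required, with $a$ clean and $b$ dirty ancillas, to implement an isometry $\Pi_n I_{n,m}\Delta_m$, in the worst case over all permutation gates $\Pi_n$ on $n$ qubits and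 diagonal gates $\Delta_m$ on $m$ qubits, where $I_{n,m}$ denotes the first $2^m$ columns of the identity on $n$ qubits. **Lemma.** Let $W$ be an isometry from $m$ to $n$ qubits. Then: 1. For all $a,b\ge 0$, using one additional clean ancilla (so $a+1$ clean and $b$ dirty ancillas in total), $W$ can be implemented with at most $$\sum_{i=0}^{2^m-1}\mathcal N_H^{\Delta\Pi}(n+1,s(i))+\mathcal N_{\Pi I\Delta}(n+1,m)$$ CNOTs, where $s(i)=\lceil\log_2(1+\operatorname{nnz}(W|i\rangle))\rceil$. 2. With one clean and one dirty ancilla, $W$ can be implemented with at most $$(17n+12)\operatorname{nnz}(W)+(34n+34m-5)2^m$$ CNOTs. 3. If $n\ge 1$, then with $\lceil n/2\rceil$ clean ancillas, $W$ can be implemented with at most $$(7n+4)\operatorname{nnz}(W)+(14n+24m-21)2^m$$ CNOTs. -/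

import Mathlib

namespace SparseIsometry

/-- Elementary gates on a finite set `Q` of qubits: an arbitrary single-qubit unitary `U` on the
qubit `q`, or a CNOT with control `c` and target `t`. The computational basis states of the qubits
in `Q` are the bit strings `Q → Bool` (with `false` for `|0⟩` and `true` for `|1⟩`). -/
inductive Gate (Q : Type) where
  | single (q : Q) (U : Matrix.unitaryGroup Bool ℂ) : Gate Q
  | cnot (c t : Q) (hct : c ≠ t) : Gate Q

/-- The matrix of a gate in the computational basis (row index = output, column index = input). -/
def Gate.toMatrix {Q : Type} [Fintype Q] [DecidableEq Q] :
    Gate Q → Matrix (Q → Bool) (Q → Bool) ℂ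
  | .single q U => Matrix.of fun y x =>
      if y = Function.update x q (y q) then U.1 (y q) (x q) else 0
  | .cnot c t _ => Matrix.of fun y x =>
      if y = Function.update x t (xor (x t) (x c)) then 1 else 0

/-- A circuit is a list of gates; the head of the list is applied first. -/
abbrev Circuit (Q : Type) := List (Gate Q)

/-- The operator of a circuit in the computational basis. -/
noncomputable def Circuit.toMatrix {Q : Type} [Fintype Q] [DecidableEq Q] :
    Circuit Q → Matrix (Q → Bool) (Q → Bool) ℂ
  | [] => 1
  | g :: gs => Circuit.toMatrix gs * g.toMatrix

/-- The number of CNOT gates of a circuit. Single-qubit gates are free. -/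
def Circuit.cnotCount {Q : Type} : Circuit Q → ℕ
  | [] => 0
  | .single _ _ :: gs => Circuit.cnotCount gs
  | .cnot _ _ _ :: gs => Circuit.cnotCount gs + 1

/-- A register of `n` qubits together with `a` clean and `b` dirty ancillas. -/
abbrev Register (n a b : ℕ) := Fin n ⊕ (Fin a ⊕ Fin b)

/-- The basis state of a register that is `y` on the `n` qubits, `z` on the clean and `d` on the
dirty ancillas. -/
def basisState {n a b : ℕ} (y : Fin n → Bool) (z : Fin a → Bool) (d : Fin b → Bool) :
    Register n a b → Bool :=
  Sum.elim y (Sum.elim z d)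

/-- The `n`-bit string that is `x` on the first `m` positions and `0` on the others
(used for `m ≤ n`). -/
def pad (n : ℕ) {m : ℕ} (x : Fin m → Bool) : Fin n → Bool :=
  fun i => if h : (i : ℕ) < m then x ⟨i, h⟩ else false

/-- The circuit `C` implements the operator `A` from `m` to `n` qubits with `a` clean and `b` dirty
ancillas: for every `m`-qubit basis state `x` and every basis state `d` of the dirty ancillas it
maps `|x⟩ ⊗ |0⟩` (on the `n` qubits), `|0⟩` (on the clean ancillas), `|d⟩` (on the dirty ancillas)
to the product of `A |x⟩`, `|0⟩` and `|d⟩`. By linearity the dirty ancillas are then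
restored from every initial state. -/
def Implements {n m a b : ℕ} (C : Circuit (Register n a b))
    (A : Matrix (Fin n → Bool) (Fin m → Bool) ℂ) : Prop :=
  ∀ (x : Fin m → Bool) (d : Fin b → Bool)
    (y : Fin n → Bool) (z : Fin a → Bool) (e : Fin b → Bool),
    C.toMatrix (basisState y z e) (basisState (pad n x) (fun _ => false) d) =
      if z = (fun _ => false) ∧ e = d then A y x else 0

/-- The least number of CNOTs in a circuit that implements some operator of the set `S` with `a`
clean and `b` dirty ancillas (`⊤` if there is no such circuit). -/
noncomputable def minCNOT {n m : ℕ} (a b : ℕ)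
    (S : Set (Matrix (Fin n → Bool) (Fin m → Bool) ℂ)) : ℕ∞ :=
  ⨅ (C : Circuit (Register n a b)) (_ : ∃ A ∈ S, Implements C A), (C.cnotCount : ℕ∞)

/-- The number of non-zero entries. -/
noncomputable def nnz {ι : Type} [Fintype ι] (v : ι → ℂ) : ℕ :=
  (Finset.univ.filter fun i => v i ≠ 0).card

/-- `W` is an isometry: `W† W = 1`. -/
def IsIsometry {n m : ℕ} (W : Matrix (Fin n → Bool) (Fin m → Bool) ℂ) : Prop :=
  W.conjTranspose * W = 1

/-- Diagonal gates on `n` qubits. -/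
def IsDiagonalGate {n : ℕ} (D : Matrix (Fin n → Bool) (Fin n → Bool) ℂ) : Prop :=
  ∃ δ : (Fin n → Bool) → ℂ, (∀ x, ‖δ x‖ = 1) ∧ D = Matrix.diagonal δ

/-- Permutation gates on `n` qubits: arbitrary permutations of the computational basis. -/
def IsPermutationGate {n : ℕ} (P : Matrix (Fin n → Bool) (Fin n → Bool) ℂ) : Prop :=
  ∃ π : Equiv.Perm (Fin n → Bool), P = π.permMatrix ℂ

/-- The isometry `I_{n,m}` from `m` to `n` qubits, `|x⟩ ↦ |x⟩ ⊗ |0⟩`. -/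
def stdIsometry (n m : ℕ) : Matrix (Fin n → Bool) (Fin m → Bool) ℂ :=
  Matrix.of fun y x => if y = pad n x then 1 else 0

/-- The standard Householder reflection `H_v = I - 2 |v⟩⟨v|`. -/
noncomputable def householder {n : ℕ} (v : (Fin n → Bool) → ℂ) :
    Matrix (Fin n → Bool) (Fin n → Bool) ℂ :=
  1 - (2 : ℂ) • Matrix.vecMulVec v (star v)

/-- `N_H^{ΔΠ}(n, s)`: the number of CNOTs required, with `a` clean and `b` dirty ancillas, to
implement `H_v` up to a diagonal and a permutation gate, in the worst case over all `n`-qubit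
states `v` with at most `2 ^ s` non-zero entries. -/
noncomputable def householderCost (a b n s : ℕ) : ℕ∞ :=
  ⨆ (v : (Fin n → Bool) → ℂ) (_ : ∑ x, ‖v x‖ ^ 2 = 1) (_ : nnz v ≤ 2 ^ s),
    minCNOT a b {A | ∃ D P, IsDiagonalGate D ∧ IsPermutationGate P ∧ A = D * P * householder v}

/-- `N_{ΠIΔ}(n, m)`: the number of CNOTs required, with `a` clean and `b` dirty ancillas, to
implement a permuted diagonal isometry `Π_n I_{n,m} Δ_m`, in the worst case over all permutation
gates `Π_n` on `n` qubits and diagonal gates `Δ_m` on `m` qubits. -/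
noncomputable def permDiagCost (a b n m : ℕ) : ℕ∞ :=
  ⨆ (P : Matrix (Fin n → Bool) (Fin n → Bool) ℂ) (D : Matrix (Fin m → Bool) (Fin m → Bool) ℂ)
    (_ : IsPermutationGate P) (_ : IsDiagonalGate D),
    minCNOT a b {P * stdIsometry n m * D}

end SparseIsometry

/-! Add one marker qubit. Let `w x` be the column `W|x⟩` with marker `0`, and `e x` the basis state
`x`, padded by zeros, with marker `1`. Both systems are orthonormal and the marker makes them
mutually orthogonal. Hence `(e x - w x) / √2` is a unit vector with at most `1 + nnz (W|x⟩)`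
non-zero entries. Its Householder reflection swaps `e x` and `w x` and fixes all other `e y` and `w
y`, so the product `G` of these reflections sends every `w x` to `e x`.

Implementing a reflection only up to a monomial (diagonal times permutation) factor `M` does no
harm: `H_{Mv} M = M H_v`, and `M v` has no more non-zero entries than `v`. So all monomial factors
can be collected on the left (`exists_householder_product`). The resulting unitary `M G` turns `W`
into a permuted diagonal isometry. Inverting the circuit of `M G` and prepending one for that
isometry gives `W` (`exists_implements_extend`). The marker starts and ends in `|0⟩`, so it is the
extra clean ancilla (`Implements.relabel`).

The explicit bounds are derived with one parameter `c`, the cost of any multi-controlled NOT on `n +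
1` qubits (`HasMcx`). For a reflection (`HasMcx.householder`), pivots costing `n + c` each move the
support into a subcube of about its own size. A diagonal gate there makes the amplitudes
non-negative, and the reflection about a state prepared from `|0⟩` is a conjugated multi-controlled
`Z`. The permuted diagonal isometry is a product of transpositions and a diagonal gate
(`HasMcx.permDiag`). It remains to bound `c`: `16 n` with one dirty ancilla, and `6 n - 5` with
about `n / 2` clean ones. Both come from ladders of relative-phase gates whose phases cancel when
the ladder is undone (`Ladder.conj`). -/

namespace SparseIsometry

open Matrix Function

/-! ### Multiplexed single-qubit operators and monomial matrices -/

section Mux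

variable {Q Q' : Type} [Fintype Q] [DecidableEq Q] [Fintype Q'] [DecidableEq Q']

/-- The operator that applies to the qubit `q` the `2 × 2` matrix `U x`, which may depend on the
basis state `x`. -/
def mux (q : Q) (U : (Q → Bool) → Matrix Bool Bool ℂ) : Matrix (Q → Bool) (Q → Bool) ℂ :=
  Matrix.of fun y x => if y = update x q (y q) then U x (y q) (x q) else 0

/-- The matrix that maps the basis state `x` to `φ x` times the basis state `f x`. -/
def mono {α β : Type} [DecidableEq β] (f : α → β) (φ : α → ℂ) : Matrix β α ℂ :=
  Matrix.of fun y x => if y = f x then φ x else 0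

/-- The matrix of the NOT gate if `e` is true, and the identity otherwise. -/
def notPow (e : Bool) : Matrix Bool Bool ℂ := Matrix.of fun i j => if i = xor j e then 1 else 0

/-- Negation of the bit `t` under the condition `g`. -/
def flipBit (t : Q) (g : (Q → Bool) → Bool) (x : Q → Bool) : Q → Bool := update x t (xor (x t) (g x))

/-- The function does not depend on the bit `q`. -/
def IndepOf {γ : Type*} (q : Q) (g : (Q → Bool) → γ) : Prop := ∀ x b, g (update x q b) = g x

theorem notPow_false : notPow false = 1 := by
  ext i j; cases i <;> cases j <;> simp [notPow]

theorem notPow_mul (e e' : Bool) : notPow e * notPow e' = notPow (xor e e') := by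
  ext i j
  rw [Matrix.mul_apply, Fintype.sum_bool]
  cases i <;> cases j <;> cases e <;> cases e' <;> simp [notPow]

theorem notPow_conjTranspose (e : Bool) : (notPow e)ᴴ = notPow e := by
  ext i j
  cases i <;> cases j <;> cases e <;> simp [notPow]

theorem notPow_mul_self (e : Bool) : notPow e * notPow e = 1 := by
  rw [notPow_mul, Bool.xor_self, notPow_false]

theorem mul_mux_apply {α : Type} (A : Matrix α (Q → Bool) ℂ) (t : Q)
    (U : (Q → Bool) → Matrix Bool Bool ℂ) (y : α) (x : Q → Bool) :
    (A * mux t U) y x = ∑ b, A y (update x t b) * U x b (x t) := by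
  rw [Matrix.mul_apply]
  symm
  refine Finset.sum_of_injOn (fun b => update x t b) ?_ (by simp) ?_ ?_
  · intro b _ b' _ h
    simpa using congrFun h t
  · intro z _ hz
    have : z ≠ update x t (z t) := fun h => hz ⟨z t, by simp, h.symm⟩
    simp [mux, this]
  · intro b _
    simp [mux]

theorem mul_mono_apply {α β γ : Type} [Fintype β] [DecidableEq β] (A : Matrix γ β ℂ) (f : α → β)
    (φ : α → ℂ) (y : γ) (x : α) : (A * mono f φ) y x = A y (f x) * φ x := by
  rw [Matrix.mul_apply, Finset.sum_eq_single (f x)]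
  · simp [mono]
  · intro z _ hz; simp [mono, hz]
  · simp

theorem mono_mul_mono {α β γ : Type} [Fintype β] [DecidableEq β] [DecidableEq γ]
    (g : β → γ) (ψ : β → ℂ) (f : α → β) (φ : α → ℂ) :
    mono g ψ * mono f φ = mono (g ∘ f) (fun x => ψ (f x) * φ x) := by
  ext y x
  rw [mul_mono_apply]
  simp [mono]

theorem mono_id_one {α : Type} [DecidableEq α] : mono (id : α → α) (fun _ => 1) = 1 := by
  ext y x; simp [mono, Matrix.one_apply]

theorem mono_id {α : Type} [DecidableEq α] (φ : α → ℂ) : mono id φ = Matrix.diagonal φ := by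
  ext y x
  by_cases h : y = x <;> simp [mono, Matrix.diagonal, h]

/-- The hypothesis on `F` says that the map carries bit `t'` to bit `t` and lets it influence
nothing else, so an operation on this bit can be moved across with its controls read off after `F`.
This serves both for undoing ladders and for passing between the register and its `n` data qubits.
-/
theorem mux_mul_mono (t : Q) (t' : Q') (F : (Q' → Bool) → (Q → Bool)) (φ : (Q' → Bool) → ℂ)
    (U : (Q → Bool) → Matrix Bool Bool ℂ) (hF : ∀ x b, F (update x t' b) = update (F x) t b)
    (hφ : IndepOf t' φ) : mux t U * mono F φ = mono F φ * mux t' (fun x => U (F x)) := by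
  ext y x
  have h : F x t = x t' := by
    have := congrFun (hF x (x t')) t
    rwa [update_eq_self, update_self] at this
  rw [mul_mono_apply, mul_mux_apply]
  simp only [mono, mux, Matrix.of_apply, hF, h, hφ x]
  by_cases hy : y = update (F x) t (y t)
  · rw [Finset.sum_eq_single (y t)]
    · rw [if_pos hy, if_pos hy, mul_comm]
    · intro b _ hb
      rw [if_neg, zero_mul]
      intro h'
      apply hb
      rw [h', update_self]
    · simp
  · rw [if_neg hy, zero_mul, Finset.sum_eq_zero]
    intro b _
    rw [if_neg, zero_mul]
    intro h'
    apply hy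
    rw [h']; simp

theorem mux_mul_mux (t : Q) (U V : (Q → Bool) → Matrix Bool Bool ℂ) (hU : IndepOf t U) :
    mux t U * mux t V = mux t (fun x => U x * V x) := by
  ext y x
  rw [mul_mux_apply]
  simp only [mux, Matrix.of_apply, hU x, update_idem, update_self]
  split_ifs
  · rw [Matrix.mul_apply]
  · simp

theorem mux_one (t : Q) : mux t (fun _ => 1) = 1 := by
  ext y x
  by_cases h : y = x
  · subst h; simp [mux]
  · simp only [mux, Matrix.of_apply, Matrix.one_apply, h, if_false]
    split_ifs with h1 h2
    · exact absurd (by rw [h1, h2, update_eq_self]) h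
    · rfl
    · rfl

theorem mux_conjTranspose (t : Q) (U : (Q → Bool) → Matrix Bool Bool ℂ) (hU : IndepOf t U) :
    (mux t U)ᴴ = mux t (fun x => (U x)ᴴ) := by
  ext y x
  simp only [mux, Matrix.of_apply, Matrix.conjTranspose_apply]
  by_cases h : y = update x t (y t)
  · have h' : x = update y t (x t) := by rw [h]; simp
    rw [if_pos h, if_pos h']
    have : U y = U x := by rw [h, hU]
    rw [this]
  · have h' : x ≠ update y t (x t) := fun h' => h (by rw [h']; simp)
    rw [if_neg h, if_neg h', star_zero]

theorem mux_eq_mono (t : Q) (U : (Q → Bool) → Matrix Bool Bool ℂ) (g : (Q → Bool) → Bool)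
    (φ : (Q → Bool) → ℂ) (h : ∀ x i, U x i (x t) = if i = xor (x t) (g x) then φ x else 0) :
    mux t U = mono (flipBit t g) φ := by
  ext y x
  simp only [mux, mono, Matrix.of_apply, h]
  by_cases hy : y = flipBit t g x
  · rw [if_pos hy, if_pos, if_pos]
    · rw [hy]; simp [flipBit]
    · rw [hy]; simp [flipBit]
  · rw [if_neg hy]
    split_ifs with h1 h2
    · exact absurd (by rw [h1, h2]; rfl) hy
    · rfl
    · rfl

theorem mux_notPow (t : Q) (g : (Q → Bool) → Bool) :
    mux t (fun x => notPow (g x)) = mono (flipBit t g) (fun _ => 1) :=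
  mux_eq_mono t _ g _ fun x i => by simp [notPow]

end Mux

/-! ### Circuits and their cost -/

section Cost

variable {Q : Type} [Fintype Q] [DecidableEq Q]

theorem Gate.toMatrix_single (q : Q) (U : Matrix.unitaryGroup Bool ℂ) :
    (Gate.single q U).toMatrix = mux q (fun _ => U.1) := rfl

theorem Gate.toMatrix_cnot (c t : Q) (h : c ≠ t) :
    (Gate.cnot c t h).toMatrix = mux t (fun x => notPow (x c)) := by
  rw [mux_notPow]; rfl

theorem Circuit.toMatrix_append (C D : Circuit Q) :
    Circuit.toMatrix (C ++ D) = Circuit.toMatrix D * Circuit.toMatrix C := by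
  induction C with
  | nil => simp [Circuit.toMatrix]
  | cons g gs ih => simp [Circuit.toMatrix, ih, Matrix.mul_assoc]

theorem Circuit.cnotCount_append {Q : Type} (C D : Circuit Q) :
    Circuit.cnotCount (C ++ D) = C.cnotCount + D.cnotCount := by
  induction C with
  | nil => simp [Circuit.cnotCount]
  | cons g gs ih =>
    cases g
    · simp [Circuit.cnotCount, ih]
    · simp [Circuit.cnotCount, ih]; omega

/-- The inverse of a gate. -/
def Gate.inv : Gate Q → Gate Q
  | .single q U => .single q U⁻¹
  | .cnot c t h => .cnot c t h

theorem Gate.toMatrix_inv (g : Gate Q) : g.inv.toMatrix = g.toMatrixᴴ := by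
  cases g with
  | single q U =>
    rw [Gate.inv, Gate.toMatrix_single, Gate.toMatrix_single, mux_conjTranspose _ _ fun _ _ => rfl]
    rfl
  | cnot c t h =>
    rw [Gate.inv, Gate.toMatrix_cnot, mux_conjTranspose]
    · simp [notPow_conjTranspose]
    · intro x b; simp [h]

theorem Gate.toMatrix_mul_inv (g : Gate Q) : g.toMatrix * g.toMatrixᴴ = 1 := by
  rw [← Gate.toMatrix_inv]
  cases g with
  | single q U =>
    rw [Gate.inv, Gate.toMatrix_single, Gate.toMatrix_single, mux_mul_mux _ _ _ fun _ _ => rfl,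
      ← mux_one q]
    congr
    funext x
    exact congrArg Subtype.val (mul_inv_cancel U)
  | cnot c t h =>
    rw [Gate.inv, Gate.toMatrix_cnot, mux_mul_mux]
    · simp [notPow_mul_self, mux_one]
    · intro x b; simp [h]

/-- The inverse of a circuit. -/
def Circuit.inv : Circuit Q → Circuit Q
  | [] => []
  | g :: gs => Circuit.inv gs ++ [g.inv]

theorem Circuit.toMatrix_inv (C : Circuit Q) :
    Circuit.toMatrix (Circuit.inv C) = (Circuit.toMatrix C)ᴴ := by
  induction C with
  | nil => simp [Circuit.inv, Circuit.toMatrix]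
  | cons g gs ih =>
    simp [Circuit.inv, Circuit.toMatrix_append, ih, Circuit.toMatrix, Gate.toMatrix_inv]

theorem Circuit.cnotCount_inv {Q : Type} (C : Circuit Q) : (Circuit.inv C).cnotCount = C.cnotCount := by
  induction C with
  | nil => rfl
  | cons g gs ih =>
    rw [Circuit.inv, Circuit.cnotCount_append, ih]
    cases g <;> simp [Circuit.cnotCount, Gate.inv]

theorem Circuit.mul_conjTranspose (C : Circuit Q) :
    Circuit.toMatrix C * (Circuit.toMatrix C)ᴴ = 1 := by
  induction C with
  | nil => simp [Circuit.toMatrix]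
  | cons g gs ih =>
    rw [Circuit.toMatrix, Matrix.conjTranspose_mul, Matrix.mul_assoc,
      ← Matrix.mul_assoc g.toMatrix, Gate.toMatrix_mul_inv, Matrix.one_mul, ih]

/-- The operator `A` is the operator of a circuit with at most `c` CNOTs. -/
def Cost (A : Matrix (Q → Bool) (Q → Bool) ℂ) (c : ℕ) : Prop :=
  ∃ C : Circuit Q, C.toMatrix = A ∧ C.cnotCount ≤ c

variable {A B : Matrix (Q → Bool) (Q → Bool) ℂ} {c d : ℕ}

theorem Cost.le (h : Cost A c) (hcd : c ≤ d) : Cost A d := by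
  obtain ⟨C, h1, h2⟩ := h
  exact ⟨C, h1, h2.trans hcd⟩

theorem Cost.mul (hA : Cost A c) (hB : Cost B d) : Cost (A * B) (c + d) := by
  obtain ⟨C, rfl, h2⟩ := hA
  obtain ⟨D, rfl, h4⟩ := hB
  exact ⟨D ++ C, Circuit.toMatrix_append _ _, by rw [Circuit.cnotCount_append]; omega⟩

theorem Cost.inv (hA : Cost A c) : Cost Aᴴ c := by
  obtain ⟨C, rfl, h2⟩ := hA
  exact ⟨Circuit.inv C, Circuit.toMatrix_inv _, by rwa [Circuit.cnotCount_inv]⟩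

theorem Cost.mul_conjTranspose (hA : Cost A c) : A * Aᴴ = 1 := by
  obtain ⟨C, rfl, -⟩ := hA
  exact Circuit.mul_conjTranspose C

theorem Cost.conjTranspose_mul (hA : Cost A c) : Aᴴ * A = 1 :=
  mul_eq_one_comm.1 hA.mul_conjTranspose

theorem Cost.one : Cost (1 : Matrix (Q → Bool) (Q → Bool) ℂ) 0 := ⟨[], rfl, le_rfl⟩

theorem Cost.single (q : Q) (U : Matrix Bool Bool ℂ) (hU : U * Uᴴ = 1) :
    Cost (mux q fun _ => U) 0 :=
  ⟨[.single q ⟨U, Matrix.mem_unitaryGroup_iff.2 hU⟩],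
    by simp [Circuit.toMatrix, Gate.toMatrix_single], le_rfl⟩

theorem Cost.cnot (c t : Q) (h : c ≠ t) : Cost (mux t fun x => notPow (x c)) 1 :=
  ⟨[.cnot c t h], by simp [Circuit.toMatrix, Gate.toMatrix_cnot], le_rfl⟩

/-- Multiplexed operators on the same qubit multiply pointwise. -/
theorem Cost.mux_mul {t : Q} {U V : (Q → Bool) → Matrix Bool Bool ℂ} (hU : IndepOf t U)
    (h : Cost (mux t U) c) (h' : Cost (mux t V) d) : Cost (mux t fun x => U x * V x) (c + d) := by
  rw [← mux_mul_mux t U V hU]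
  exact h.mul h'

end Cost

/-! ### Multiplexed rotations, diagonal gates and state preparation -/

/-- A one-parameter group of single-qubit unitaries that is inverted by conjugation with NOT. -/
structure IsRot (R : ℝ → Matrix Bool Bool ℂ) : Prop where
  zero : R 0 = 1
  add : ∀ a b, R (a + b) = R a * R b
  conj : ∀ a, (R a)ᴴ = R (-a)
  not_mul : ∀ a, notPow true * R a = R (-a) * notPow true

/-- Rotations about the `y`-axis. -/
noncomputable def rotY (θ : ℝ) : Matrix Bool Bool ℂ :=
  Matrix.of fun i j => if i = j then (Real.cos θ : ℂ) else if i then (Real.sin θ : ℂ) else -Real.sin θ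

/-- Rotations about the `z`-axis. -/
noncomputable def rotZ (θ : ℝ) : Matrix Bool Bool ℂ :=
  Matrix.diagonal fun b => Complex.exp ((if b then -θ else θ : ℝ) * Complex.I)

theorem isRot_rotY : IsRot rotY where
  zero := by ext i j; cases i <;> cases j <;> simp [rotY]
  add a b := by
    ext i j
    rw [Matrix.mul_apply, Fintype.sum_bool]
    cases i <;> cases j <;> simp [rotY, Complex.cos_add, Complex.sin_add] <;> ring
  conj a := by
    ext i j
    cases i <;> cases j <;> simp [rotY, ← Complex.cos_conj, ← Complex.sin_conj]
  not_mul a := by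
    ext i j
    rw [Matrix.mul_apply, Matrix.mul_apply, Fintype.sum_bool, Fintype.sum_bool]
    cases i <;> cases j <;> simp [rotY, notPow]

theorem isRot_rotZ : IsRot rotZ where
  zero := by simp [rotZ]
  add a b := by
    rw [rotZ, rotZ, rotZ, Matrix.diagonal_mul_diagonal]
    congr 1
    funext i
    rw [← Complex.exp_add]
    cases i <;> simp <;> ring_nf
  conj a := by
    rw [rotZ, rotZ, Matrix.diagonal_conjTranspose]
    congr 1
    funext i
    simp only [Pi.star_apply, Complex.star_def, ← Complex.exp_conj]
    cases i <;> simp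
  not_mul a := by
    rw [rotZ, rotZ, ← Matrix.ext_iff]
    intro i j
    rw [Matrix.mul_diagonal, Matrix.diagonal_mul]
    cases i <;> cases j <;> simp [notPow]

theorem IsRot.mul_conj {R : ℝ → Matrix Bool Bool ℂ} (hR : IsRot R) (a : ℝ) :
    R a * (R a)ᴴ = 1 := by
  rw [hR.conj, ← hR.add, add_neg_cancel, hR.zero]

theorem IsRot.notPow_mul_rot {R : ℝ → Matrix Bool Bool ℂ} (hR : IsRot R) (e : Bool) (a : ℝ) :
    notPow e * R a = R (if e then -a else a) * notPow e := by
  cases e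
  · simp [notPow_false]
  · simp [hR.not_mul]

theorem IsRot.mul_notPow_mul {R : ℝ → Matrix Bool Bool ℂ} (hR : IsRot R) (e : Bool) (a b : ℝ) :
    R a * notPow e * R b = R (a + if e then -b else b) * notPow e := by
  rw [Matrix.mul_assoc, hR.notPow_mul_rot, ← Matrix.mul_assoc, ← hR.add]

section

variable {Q : Type} [Fintype Q] [DecidableEq Q]

theorem indepOf_of_dependsOn {Q : Type} [DecidableEq Q] {γ : Type*} {g : (Q → Bool) → γ} {S : Finset Q}
    (hg : DependsOn g (S : Set Q)) {q : Q} (hq : q ∉ S) : IndepOf q g := fun x b =>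
  hg fun i hi => update_of_ne (by rintro rfl; exact hq hi) _ _

theorem dependsOn_update {Q : Type} [DecidableEq Q] {γ : Type*} {g : (Q → Bool) → γ} {S : Finset Q} {q : Q}
    (hg : DependsOn g (insert q S : Finset Q)) (b : Bool) :
    DependsOn (fun x => g (update x q b)) (S : Set Q) := fun x y hxy =>
  hg fun i hi => by
    by_cases h : i = q
    · subst h; simp
    · rw [update_of_ne h, update_of_ne h]
      exact hxy i (by simpa [h] using hi)

/-- Conjugation by NOT inverts the rotation, so with `α` and `β` the half sum and half difference of
the angles at `x c = 0, 1`, one has `R θ X^{x c} = R α X^{x c} R β`. Neither `α` nor `β` depends on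
`c`. Keeping a trailing CNOT in the statement lets the inner CNOTs of the recursion cancel, which
gives `2 N + 1` from `N`. -/
theorem IsRot.cost_mux_mul_notPow {R : ℝ → Matrix Bool Bool ℂ} (hR : IsRot R) (t : Q)
    (S : Finset Q) : ∀ (c : Q) (θ : (Q → Bool) → ℝ), c ∉ S → t ∉ S → c ≠ t →
      DependsOn θ (insert c S : Finset Q) →
      Cost (mux t fun x => R (θ x) * notPow (x c)) (2 ^ (S.card + 1) - 1) := by
  have key : ∀ (c : Q) (θ : (Q → Bool) → ℝ) x, R (θ x) * notPow (x c) =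
      R ((θ (update x c false) + θ (update x c true)) / 2) * notPow (x c) *
        R ((θ (update x c false) - θ (update x c true)) / 2) := by
    intro c θ x
    rw [hR.mul_notPow_mul]
    congr 2
    obtain h | h := Bool.eq_false_or_eq_true (x c)
    · rw [h]
      nth_rw 1 [← update_eq_self c x, h]
      simp; ring
    · rw [h]
      nth_rw 1 [← update_eq_self c x, h]
      simp; ring
  induction S using Finset.induction_on with
  | empty =>
    intro c θ _ _ hct hθ
    have h0 := dependsOn_update hθ false
    have h1 := dependsOn_update hθ true
    have e : (fun x => R (θ x) * notPow (x c)) = fun x =>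
        R ((θ (update (fun _ => false) c false) + θ (update (fun _ => false) c true)) / 2) *
          notPow (x c) *
        R ((θ (update (fun _ => false) c false) - θ (update (fun _ => false) c true)) / 2) := by
      funext x
      have e0 : θ (update x c false) = _ := h0 (x := x) (y := fun _ => false) (by simp)
      have e1 : θ (update x c true) = _ := h1 (x := x) (y := fun _ => false) (by simp)
      rw [key, e0, e1]
    rw [e]
    refine Cost.le (c := 0 + 1 + 0) (Cost.mux_mul ?_ (Cost.mux_mul ?_ ?_ ?_) ?_) (by simp)
    · intro x b; simp [hct]
    · intro x b; rfl
    · exact Cost.single t _ (hR.mul_conj _)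
    · exact Cost.cnot c t hct
    · exact Cost.single t _ (hR.mul_conj _)
  | insert c' S' hc' ih =>
    intro c θ hcS htS hct hθ
    simp only [Finset.mem_insert, not_or] at hcS htS
    have h0 := dependsOn_update hθ false
    have h1 := dependsOn_update hθ true
    have ha := ih c' (fun x => (θ (update x c false) + θ (update x c true)) / 2) hc' htS.2
      (Ne.symm htS.1) (fun x y h => by simp only [h0 h, h1 h])
    -- The right factor is needed in the mirrored form `X^{x c'} R β`, which is the adjoint of `R
    -- (-β) X^{x c'}`. The two copies of `X^{x c'}` then cancel across the CNOT controlled by `c`.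
    have hb := ih c' (fun x => -((θ (update x c false) - θ (update x c true)) / 2)) hc' htS.2
      (Ne.symm htS.1) (fun x y h => by simp only [h0 h, h1 h])
    have htS' : t ∉ insert c' S' := by simp [htS]
    have i0 := indepOf_of_dependsOn h0 htS'
    have i1 := indepOf_of_dependsOn h1 htS'
    have hne : t ≠ c' := htS.1
    have hb' := hb.inv
    rw [mux_conjTranspose] at hb'
    swap
    · intro x b
      have := i0 x b; have := i1 x b
      simp_all [hne.symm]
    have := Cost.mux_mul ?_ (Cost.mux_mul ?_ ha (Cost.cnot c t hct)) hb'
    · refine Cost.le (c := (2 ^ (S'.card + 1) - 1 + 1) + (2 ^ (S'.card + 1) - 1)) ?_ ?_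
      · convert this using 2
        funext x
        rw [key, Matrix.conjTranspose_mul, notPow_conjTranspose, hR.conj, neg_neg]
        simp only [Matrix.mul_assoc]
        rw [← Matrix.mul_assoc (notPow (x c')) (notPow (x c)), notPow_mul,
          ← Matrix.mul_assoc _ (notPow (x c')), notPow_mul, Bool.xor_comm, ← Bool.xor_assoc,
          Bool.xor_self, Bool.false_xor]
      · rw [Finset.card_insert_of_notMem hc', pow_succ 2 (S'.card + 1)]
        have : 1 ≤ 2 ^ (S'.card + 1) := Nat.one_le_two_pow
        omega
    · intro x b
      have := i0 x b; have := i1 x b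
      simp_all [hne.symm]
    · intro x b
      have := i0 x b; have := i1 x b
      simp_all [hne.symm]

/-- A multiplexed rotation with `k ≥ 1` control qubits requires `2 ^ k` CNOTs. -/
theorem IsRot.cost_mux {R : ℝ → Matrix Bool Bool ℂ} (hR : IsRot R) (t : Q) (S : Finset Q)
    (ht : t ∉ S) (θ : (Q → Bool) → ℝ) (hθ : DependsOn θ (S : Set Q)) :
    Cost (mux t fun x => R (θ x)) (if S.card = 0 then 0 else 2 ^ S.card) := by
  induction S using Finset.induction_on with
  | empty =>
    have : (fun x => R (θ x)) = fun _ => R (θ fun _ => false) := by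
      funext x; rw [hθ (x := x) (y := fun _ => false) (by simp)]
    rw [this]
    exact Cost.single t _ (hR.mul_conj _)
  | insert c S hc =>
    simp only [Finset.mem_insert, not_or] at ht
    have h := hR.cost_mux_mul_notPow t S c θ hc ht.2 (Ne.symm ht.1) hθ
    have hi := indepOf_of_dependsOn hθ (q := t) (by simp [ht])
    -- One more CNOT removes the trailing `X^{x c}`.
    refine Cost.le (c := 2 ^ (S.card + 1) - 1 + 1) ?_ ?_
    · convert Cost.mux_mul ?_ h (Cost.cnot c t (Ne.symm ht.1)) using 2
      · funext x
        rw [Matrix.mul_assoc, notPow_mul_self, Matrix.mul_one]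
      · intro x b
        have := hi x b
        have := ht.1
        simp_all [Ne.symm ht.1]
    · rw [Finset.card_insert_of_notMem hc, if_neg (by omega)]
      have : 1 ≤ 2 ^ (S.card + 1) := Nat.one_le_two_pow
      omega

theorem mux_diagonal (t : Q) (δ : (Q → Bool) → Bool → ℂ) :
    mux t (fun x => Matrix.diagonal (δ x)) = mono id fun x => δ x (x t) := by
  rw [mux_eq_mono t _ (fun _ => false) (fun x => δ x (x t))]
  · congr 1
    funext x
    simp [flipBit]
  · intro x i
    by_cases h : i = x t <;> simp [h, Matrix.diagonal]

/-- Splitting the phase by the bit `t`, the half difference is a multiplexed `z`-rotation on `t`,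
and the mean is a diagonal gate on one qubit fewer. The costs add up as `2 ^ k + (2 ^ k - 2)`. The
base case is a global phase, which needs some qubit to act on. -/
theorem cost_diag_exp [Nonempty Q] (S : Finset Q) : ∀ (α : (Q → Bool) → ℝ),
    DependsOn α (S : Set Q) →
    Cost (mono id fun x => Complex.exp (α x * Complex.I)) (2 ^ S.card - 2) := by
  induction S using Finset.induction_on with
  | empty =>
    intro α hα
    obtain ⟨q⟩ := ‹Nonempty Q›
    have := Cost.single q (Matrix.diagonal fun _ => Complex.exp (α (fun _ => false) * Complex.I)) ?_
    · rw [mux_diagonal q fun _ _ => Complex.exp (α (fun _ => false) * Complex.I)] at this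
      convert this using 3 with x
      · rw [hα (x := x) (y := fun _ => false) (by simp)]
      · simp
    · rw [Matrix.diagonal_conjTranspose, Matrix.diagonal_mul_diagonal, ← Matrix.diagonal_one]
      congr 1
      funext i
      simp [← Complex.exp_conj, ← Complex.exp_add]
  | insert t S ht ih =>
    intro α hα
    have h0 := dependsOn_update hα false
    have h1 := dependsOn_update hα true
    have h2 := isRot_rotZ.cost_mux t S ht
      (fun x => (α (update x t false) - α (update x t true)) / 2)
      (fun x y h => by simp only [h0 h, h1 h])
    have h3 := ih (fun x => (α (update x t false) + α (update x t true)) / 2)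
      (fun x y h => by simp only [h0 h, h1 h])
    refine Cost.le (Cost.mul h2 h3 |> fun h => ?_) (d := 2 ^ (insert t S).card - 2)
      (c := (if S.card = 0 then 0 else 2 ^ S.card) + (2 ^ S.card - 2)) ?_
    · convert h using 1
      simp only [rotZ]
      rw [mux_diagonal, mono_mul_mono]
      congr 1
      funext x
      simp only [id]
      rw [← Complex.exp_add, ← add_mul]
      congr 2
      obtain h | h := Bool.eq_false_or_eq_true (x t)
      · rw [h]
        nth_rw 1 [← update_eq_self t x, h]
        simp; ring
      · rw [h]
        nth_rw 1 [← update_eq_self t x, h]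
        simp; ring
    · rw [Finset.card_insert_of_notMem ht]
      split_ifs with h
      · simp [h]
      · have : 2 ^ 1 ≤ 2 ^ S.card := Nat.pow_le_pow_right (by norm_num) (by omega)
        rw [pow_succ]; omega

/-- A diagonal gate on `k ≥ 1` qubits requires at most `2 ^ k - 2` CNOTs. -/
theorem cost_diag [Nonempty Q] (S : Finset Q) (φ : (Q → Bool) → ℂ) (hφ : ∀ x, ‖φ x‖ = 1)
    (h : DependsOn φ (S : Set Q)) : Cost (mono id φ) (2 ^ S.card - 2) := by
  convert cost_diag_exp S (fun x => (φ x).arg) (fun x y hxy => by simp only [h hxy]) using 2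
  funext x
  simpa [hφ x] using (Complex.norm_mul_exp_arg_mul_I (φ x)).symm

theorem mux_mul_apply {α : Type} (A : Matrix (Q → Bool) α ℂ) (t : Q)
    (U : (Q → Bool) → Matrix Bool Bool ℂ) (hU : IndepOf t U) (y : Q → Bool) (x : α) :
    (mux t U * A) y x = ∑ b, U y (y t) b * A (update y t b) x := by
  rw [Matrix.mul_apply]
  symm
  refine Finset.sum_of_injOn (fun b => update y t b) ?_ (by simp) ?_ ?_
  · intro b _ b' _ h
    simpa using congrFun h t
  · intro z _ hz
    have : y ≠ update z t (y t) := fun h => hz ⟨z t, by simp, by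
      rw [h]; simp⟩
    simp [mux, this]
  · intro b _
    simp [mux, hU y b]

/-- Basis states are grouped in pairs that differ at `t`, each pair being represented by its member
with `x t = false`. -/
theorem sum_eq_sum_update {γ : Type*} [AddCommMonoid γ] (t : Q) (f : (Q → Bool) → γ) :
    ∑ x, f x = ∑ x, if x t then 0 else f x + f (update x t true) := by
  have h : ∀ x, f x = (if x t then 0 else f x) + if x t then f x else 0 := by
    intro x; cases x t <;> simp
  have h' : ∀ x, (if x t then 0 else f x + f (update x t true)) =
      (if x t then 0 else f x) + if x t then 0 else f (update x t true) := by
    intro x; cases x t <;> simp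
  rw [Finset.sum_congr rfl fun x _ => h x, Finset.sum_congr rfl fun x _ => h' x,
    Finset.sum_add_distrib, Finset.sum_add_distrib]
  congr 1
  refine Fintype.sum_bijective (fun x => update x t (!(x t))) ?_ _ _ ?_
  · apply Function.Involutive.bijective
    intro x; simp
  · intro x
    cases h : x t
    · simp
    · have : update x t true = x := by rw [← h, update_eq_self]
      simp [this]

/-- Preparation of a state with non-negative amplitudes on `k ≥ 1` qubits requires at most
`2 ^ k - 2` CNOTs. -/
theorem cost_statePrep (T : Finset Q) : ∀ u : (Q → Bool) → ℝ, (∀ x, 0 ≤ u x) →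
    (∀ x q, q ∉ T → x q = true → u x = 0) → ∑ x, u x ^ 2 = 1 →
    ∃ V : Matrix (Q → Bool) (Q → Bool) ℂ, Cost V (2 ^ T.card - 2) ∧
      ∀ y, V y (fun _ => false) = u y := by
  induction T using Finset.induction_on with
  | empty =>
    intro u h0 hs h1
    have hz : ∀ x, x ≠ (fun _ => false) → u x = 0 := by
      intro x hx
      obtain ⟨q, hq⟩ := Function.ne_iff.1 hx
      exact hs x q (by simp) (by simpa using hq)
    refine ⟨1, Cost.one, fun y => ?_⟩
    rw [Finset.sum_eq_single (fun _ => false)] at h1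
    · by_cases hy : y = fun _ => false
      · subst hy
        rw [Matrix.one_apply_eq, (pow_eq_one_iff_of_nonneg (h0 _) (by norm_num)).1 h1]; simp
      · rw [Matrix.one_apply_ne hy, hz y hy]; simp
    · intro x _ hx; simp [hz x hx]
    · simp
  | insert t T ht ih =>
    intro u h0 hs h1
    -- Two amplitudes that differ at `t` are encoded as one complex number. Its norm is the merged
    -- amplitude to be prepared first, and its argument the angle of the `y`-rotation on `t` that
    -- splits it again.
    refine (ih (fun x => if x t then 0 else ‖(⟨u x, u (update x t true)⟩ : ℂ)‖) ?_ ?_ ?_).elim ?_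
    · intro x; split_ifs
      · exact le_rfl
      · positivity
    · intro x q hq hxq
      by_cases hqt : q = t
      · subst hqt; simp [hxq]
      · have hq' : q ∉ insert t T := by simp [hqt, hq]
        have e1 := hs x q hq' hxq
        have e2 := hs (update x t true) q hq' (by rwa [update_of_ne hqt])
        rw [e1, e2]
        split_ifs
        · rfl
        · exact norm_zero
    · rw [← h1, sum_eq_sum_update t]
      rw [sum_eq_sum_update t (fun x => u x ^ 2)]
      refine Finset.sum_congr rfl fun x _ => ?_
      cases h : x t
      · simp [Complex.sq_norm, Complex.normSq_apply]; ring
      · simp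
    · rintro V ⟨hV, hVu⟩
      -- Clearing the other bits makes the angle depend on `T` only; nothing is lost, since `u`
      -- vanishes wherever a bit outside `insert t T` is set.
      set pr : (Q → Bool) → (Q → Bool) := fun y q => if q ∈ T then y q else false with hpr
      set θ : (Q → Bool) → ℝ := fun y =>
        (⟨u (update (pr y) t false), u (update (pr y) t true)⟩ : ℂ).arg with hθ
      have hpd : DependsOn pr (T : Set Q) := by
        intro x y h
        funext q
        by_cases hq : q ∈ T
        · simp [hpr, hq, h q hq]
        · simp [hpr, hq]
      have hd : DependsOn θ (T : Set Q) := by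
        intro x y h
        simp only [hθ, hpd h]
      refine ⟨mux t (fun x => rotY (θ x)) * V,
        Cost.le (Cost.mul (isRot_rotY.cost_mux t T ht θ hd) hV) ?_, ?_⟩
      · rw [Finset.card_insert_of_notMem ht]
        split_ifs with h
        · simp [h]
        · have : 2 ^ 1 ≤ 2 ^ T.card := Nat.pow_le_pow_right (by norm_num) (by omega)
          rw [pow_succ]; omega
      · intro y
        have hi : IndepOf t θ := indepOf_of_dependsOn hd ht
        rw [mux_mul_apply _ _ _ (fun x b => by rw [hi x b]), Fintype.sum_bool, hVu, hVu]
        simp only [update_self, update_idem, if_true, Complex.ofReal_zero, mul_zero, zero_add,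
          Bool.false_eq_true, if_false]
        by_cases hy : ∃ q, q ∉ insert t T ∧ y q = true
        · obtain ⟨q, hq, hyq⟩ := hy
          have hqt : q ≠ t := by rintro rfl; simp at hq
          rw [hs y q hq hyq, hs (update y t false) q hq (by rwa [update_of_ne hqt]),
            hs (update y t true) q hq (by rwa [update_of_ne hqt])]
          have : (⟨0, 0⟩ : ℂ) = 0 := rfl
          rw [this]; simp
        · have hp : ∀ b, update (pr y) t b = update y t b := by
            intro b
            funext q
            by_cases hqt : q = t
            · subst hqt; simp
            · rw [update_of_ne hqt, update_of_ne hqt]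
              by_cases hq : q ∈ T
              · simp [hpr, hq]
              · have : ¬ (y q = true) := fun h => hy ⟨q, by simp [hqt, hq], h⟩
                simp [hpr, hq, this]
          simp only [hθ, hp]
          set z : ℂ := ⟨u (update y t false), u (update y t true)⟩ with hz
          have hc := Complex.norm_mul_cos_arg z
          have hsn := Complex.norm_mul_sin_arg z
          obtain h | h := Bool.eq_false_or_eq_true (y t)
          · have eu : u y = z.im := by
              change u y = u (update y t true)
              rw [← h, update_eq_self]
            rw [h, eu]
            simp only [rotY, Matrix.of_apply, if_true, Bool.true_eq_false, if_false]
            rw [← Complex.ofReal_mul, mul_comm, hsn]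
          · have eu : u y = z.re := by
              change u y = u (update y t false)
              rw [← h, update_eq_self]
            rw [h, eu]
            simp only [rotY, Matrix.of_apply, if_true]
            rw [← Complex.ofReal_mul, mul_comm, hc]

end

/-! ### Multi-controlled NOT gates -/

/-- The matrix of the gate `Z` if `e` is true, and the identity otherwise. -/
def zPow (e : Bool) : Matrix Bool Bool ℂ :=
  Matrix.diagonal fun b => if e && b then -1 else 1

theorem zPow_false : zPow false = 1 := by simp [zPow]

theorem zPow_mul (e e' : Bool) : zPow e * zPow e' = zPow (xor e e') := by
  rw [zPow, zPow, zPow, Matrix.diagonal_mul_diagonal]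
  congr 1
  funext b
  cases e <;> cases e' <;> cases b <;> simp

theorem sqrt_two_div_two_mul_self : ((√2 : ℝ) : ℂ) / 2 * (((√2 : ℝ) : ℂ) / 2) = 1 / 2 := by
  have : ((√2 : ℝ) : ℂ) * ((√2 : ℝ) : ℂ) = 2 := by
    rw [← Complex.ofReal_mul, Real.mul_self_sqrt (by norm_num)]; norm_num
  linear_combination this / 4

theorem rotY_mul_zPow_mul (e : Bool) :
    rotY (Real.pi / 4) * zPow e * rotY (-(Real.pi / 4)) = notPow e := by
  have h := sqrt_two_div_two_mul_self
  have h' : (√2 : ℂ) ^ 2 = 2 := by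
    rw [← Complex.ofReal_pow, Real.sq_sqrt (by norm_num)]; norm_num
  ext i j
  rw [zPow, Matrix.mul_apply, Fintype.sum_bool, Matrix.mul_diagonal, Matrix.mul_diagonal]
  simp only [rotY, Matrix.of_apply, Real.cos_neg, Real.sin_neg, Real.cos_pi_div_four,
    Real.sin_pi_div_four, notPow]
  cases i <;> cases j <;> cases e <;> simp <;> ring_nf <;> simp [h']

/-- The relative-phase gate on a target that is controlled by `c` and `e`. -/
theorem rotY_notPow_conj_zPow (c e : Bool) :
    (rotY (-(Real.pi / 8)) * notPow c * rotY (Real.pi / 8))ᴴ * zPow e *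
      (rotY (-(Real.pi / 8)) * notPow c * rotY (Real.pi / 8)) = if c then notPow e else zPow e := by
  cases c
  · rw [notPow_false, Matrix.mul_one, ← isRot_rotY.add, neg_add_cancel, isRot_rotY.zero]
    simp
  -- The NOT reverses the second rotation, so the two eighth turns add up to `rotY (-(π / 4)) *
  -- notPow true`, a basis change between `Z` and NOT. For `c` false they cancelled.
  · rw [isRot_rotY.mul_notPow_mul, Matrix.conjTranspose_mul, isRot_rotY.conj, notPow_conjTranspose]
    have e1 : (-(-(Real.pi / 8) + if true then -(Real.pi / 8) else Real.pi / 8)) = Real.pi / 4 := by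
      simp; ring
    have e2 : (-(Real.pi / 8) + if true then -(Real.pi / 8) else Real.pi / 8) = -(Real.pi / 4) := by
      simp; ring
    have h := rotY_mul_zPow_mul e
    have h2 : notPow true * notPow e * notPow true = notPow e := by
      rw [notPow_mul, notPow_mul]; cases e <;> rfl
    rw [e1, e2, if_pos rfl, ← h2, ← h]
    simp only [Matrix.mul_assoc]

section

variable {Q : Type} [Fintype Q] [DecidableEq Q]

/-- All qubits in `S` are in the state `|1⟩`. -/
def allOn (S : Finset Q) (x : Q → Bool) : Bool := decide (∀ q ∈ S, x q = true)

/-- The NOT gate on `t` controlled by the qubits in `S`. -/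
def mcx (S : Finset Q) (t : Q) : Matrix (Q → Bool) (Q → Bool) ℂ :=
  mux t fun x => notPow (allOn S x)

theorem allOn_insert (S : Finset Q) (c : Q) (x : Q → Bool) :
    allOn (insert c S) x = (x c && allOn S x) := by
  rw [Bool.eq_iff_iff]; simp [allOn]

theorem allOn_singleton (c : Q) (x : Q → Bool) : allOn {c} x = x c := by
  rw [Bool.eq_iff_iff]; simp [allOn]

theorem allOn_union (S S' : Finset Q) (x : Q → Bool) :
    allOn (S ∪ S') x = (allOn S x && allOn S' x) := by
  rw [Bool.eq_iff_iff]
  simp only [allOn, Finset.mem_union, decide_eq_true_eq, Bool.and_eq_true]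
  constructor
  · intro h; exact ⟨fun q hq => h q (.inl hq), fun q hq => h q (.inr hq)⟩
  · rintro ⟨h, h'⟩ q (hq | hq)
    exacts [h q hq, h' q hq]

theorem allOn_congr {S : Finset Q} {x y : Q → Bool} (h : ∀ q ∈ S, x q = y q) :
    allOn S x = allOn S y := by
  rw [Bool.eq_iff_iff]
  simp only [allOn, decide_eq_true_eq]
  exact forall₂_congr fun q hq => by rw [h q hq]

theorem allOn_update {S : Finset Q} {q : Q} (hq : q ∉ S) : IndepOf q (allOn S) := fun _ _ =>
  allOn_congr fun _ hp => update_of_ne (by rintro rfl; exact hq hp) _ _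

theorem indepOf_bit {Q : Type} [DecidableEq Q] {c q : Q} (h : q ≠ c) : IndepOf q fun x : Q → Bool => x c := fun _ _ =>
  update_of_ne h.symm _ _

theorem flipBit_update {Q : Type} [DecidableEq Q] {t q : Q} (h : q ≠ t) {g : (Q → Bool) → Bool} (hg : IndepOf q g)
    (x : Q → Bool) (b : Bool) : flipBit t g (update x q b) = update (flipBit t g x) q b := by
  rw [flipBit, flipBit, hg, update_of_ne h.symm, update_comm h]

theorem flipBit_apply_ne {Q : Type} [DecidableEq Q] {t q : Q} (h : q ≠ t) (g : (Q → Bool) → Bool) (x : Q → Bool) :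
    flipBit t g x q = x q := update_of_ne h _ _

theorem flipBit_apply_self {Q : Type} [DecidableEq Q] (t : Q) (g : (Q → Bool) → Bool) (x : Q → Bool) :
    flipBit t g x t = xor (x t) (g x) := update_self _ _ _

/-- A multi-controlled `Z` is a diagonal gate on the controls and the target, and rotations of the
target by `π / 4` turn `Z` into NOT. No ancilla is used. -/
theorem cost_mcx_pow (S : Finset Q) (t : Q) (ht : t ∉ S) : Cost (mcx S t) (2 ^ (S.card + 1) - 2) := by
  have : Nonempty Q := ⟨t⟩
  have h := cost_diag (insert t S) (fun x => if allOn S x && x t then -1 else 1)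
    (fun x => by split_ifs <;> simp) (fun x y h => by
      have h1 : allOn S x = allOn S y := allOn_congr fun q hq => h q (by simp [hq])
      have h2 : x t = y t := h t (by simp)
      simp only [h1, h2])
  rw [← mux_diagonal t (fun x b => if allOn S x && b then -1 else 1),
    Finset.card_insert_of_notMem ht] at h
  have h' := Cost.mux_mul (t := t) ?_ (Cost.mux_mul ?_
    (Cost.single t (rotY (Real.pi / 4)) (isRot_rotY.mul_conj _)) h)
    (Cost.single t (rotY (-(Real.pi / 4))) (isRot_rotY.mul_conj _))
  · rw [zero_add, add_zero] at h'
    convert h' using 1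
    rw [mcx]
    congr 1
    funext x
    exact (rotY_mul_zPow_mul _).symm
  · intro x b; simp only [allOn_update ht x b]
  · intro x b; rfl

theorem cost_toffoli (c c' t : Q) (h : c ≠ c') (hc : c ≠ t) (hc' : c' ≠ t) :
    Cost (mux t fun x => notPow (x c && x c')) 6 := by
  have := cost_mcx_pow {c, c'} t (by simp [hc.symm, hc'.symm])
  rw [Finset.card_pair h] at this
  refine Cost.le (c := 2 ^ (2 + 1) - 2) ?_ (by norm_num)
  convert this using 1
  rw [mcx]
  congr 1
  funext x
  rw [allOn_insert, allOn_singleton]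

theorem cost_cz (c t : Q) (h : c ≠ t) : Cost (mux t fun x => zPow (x c)) 1 := by
  have h' := Cost.mux_mul (t := t) ?_ (Cost.mux_mul ?_
    (Cost.single t (rotY (-(Real.pi / 4))) (isRot_rotY.mul_conj _)) (Cost.cnot c t h))
    (Cost.single t (rotY (Real.pi / 4)) (isRot_rotY.mul_conj _))
  · convert h' using 3 with x
    have h1 : rotY (-(Real.pi / 4)) * rotY (Real.pi / 4) = 1 := by
      rw [← isRot_rotY.add, neg_add_cancel, isRot_rotY.zero]
    rw [← rotY_mul_zPow_mul, ← Matrix.mul_assoc, ← Matrix.mul_assoc, h1, Matrix.one_mul,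
      Matrix.mul_assoc, h1, Matrix.mul_one]
  · intro x b; simp only [indepOf_bit h.symm x b]
  · intro x b; rfl

/-- The basis change on a target, controlled by `c`, that turns `Z` into NOT. -/
noncomputable def ctrlBasis (c : Bool) : Matrix Bool Bool ℂ :=
  rotY (-(Real.pi / 8)) * notPow c * rotY (Real.pi / 8)

theorem cost_ctrlBasis (c t : Q) (h : c ≠ t) : Cost (mux t fun x => ctrlBasis (x c)) 1 :=
  Cost.mux_mul (t := t) (fun x b => by simp only [indepOf_bit h.symm x b])
    (Cost.mux_mul (fun _ _ => rfl)
      (Cost.single t _ (isRot_rotY.mul_conj _)) (Cost.cnot c t h))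
    (Cost.single t _ (isRot_rotY.mul_conj _))

theorem cost_ctrlBasis_conjTranspose (c t : Q) (h : c ≠ t) :
    Cost (mux t fun x => (ctrlBasis (x c))ᴴ) 1 := by
  rw [← mux_conjTranspose t _ fun x b => by simp only [indepOf_bit h.symm x b]]
  exact (cost_ctrlBasis c t h).inv

/-- The phase of the relative-phase gate. -/
noncomputable def relPhase (c e b : Bool) : ℂ := if c then 1 else if e && b then -1 else 1

theorem mux_relPhase (t : Q) (ω : (Q → Bool) → ℂ) (c e : (Q → Bool) → Bool) :
    mux t (fun x => (ctrlBasis (c x))ᴴ * (ω x • zPow (e x)) * ctrlBasis (c x)) =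
      mono (flipBit t fun x => c x && e x) (fun x => ω x * relPhase (c x) (e x) (x t)) := by
  apply mux_eq_mono
  intro x i
  rw [Matrix.mul_smul, Matrix.smul_mul, ctrlBasis, rotY_notPow_conj_zPow]
  cases c x <;> cases e x <;> cases x t <;> cases i <;> simp [relPhase, zPow, notPow]

/-- A monomial circuit with controls `S` and ancillas `A`. -/
structure Ladder (S A : Finset Q) (F : (Q → Bool) → (Q → Bool)) (φ : (Q → Bool) → ℂ) (c : ℕ) :
    Prop where
  cost : Cost (mono F φ) c
  fix : ∀ x q, q ∉ A → F x q = x q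
  upd : ∀ q, q ∉ S → q ∉ A → ∀ x b, F (update x q b) = update (F x) q b
  phase : ∀ q, q ∉ S → q ∉ A → IndepOf q φ

/-- Run the ladder, act on `t` with controls read after it, and undo the ladder. As neither `F` (on
the other bits) nor `φ` sees `t`, the undoing restores the ancillas and cancels the relative phases,
which is why cheap relative-phase gates suffice inside ladders. -/
theorem Ladder.conj {S A : Finset Q} {F : (Q → Bool) → (Q → Bool)} {φ : (Q → Bool) → ℂ} {c d : ℕ}
    (h : Ladder S A F φ c) {t : Q} (hS : t ∉ S) (hA : t ∉ A) {U : (Q → Bool) → Matrix Bool Bool ℂ}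
    (hU : Cost (mux t U) d) : Cost (mux t fun x => U (F x)) (2 * c + d) := by
  have := (h.cost.inv.mul hU).mul h.cost
  rw [Matrix.mul_assoc, mux_mul_mono t t F φ U (h.upd t hS hA) (h.phase t hS hA),
    ← Matrix.mul_assoc, h.cost.conjTranspose_mul, Matrix.one_mul] at this
  exact this.le (by omega)

theorem Ladder.mono_cost {S A : Finset Q} {F : (Q → Bool) → (Q → Bool)} {φ : (Q → Bool) → ℂ} {c d : ℕ}
    (h : Ladder S A F φ c) (hcd : c ≤ d) : Ladder S A F φ d :=
  ⟨h.cost.le hcd, h.fix, h.upd, h.phase⟩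

/-- A Toffoli gate up to relative phase: a controlled `Z` between a controlled basis change and its
inverse, one CNOT each. -/
theorem ladder_pair {c c' a : Q} (hc : c ≠ a) (hc' : c' ≠ a) :
    ∃ F φ, Ladder {c, c'} {a} F φ 3 ∧ ∀ x, F x a = xor (x a) (allOn {c, c'} x) := by
  have h := Cost.mux_mul (t := a) ?_ (Cost.mux_mul ?_ (cost_ctrlBasis_conjTranspose c a hc)
    (cost_cz c' a hc')) (cost_ctrlBasis c a hc)
  · have e := mux_relPhase a (fun _ => 1) (fun x => x c) (fun x => x c')
    simp only [one_smul] at e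
    rw [e] at h
    refine ⟨_, _, ⟨h, ?_, ?_, ?_⟩, ?_⟩
    · intro x q hq; exact flipBit_apply_ne (by simpa using hq) _ _
    · intro q hq hqa x b
      simp only [Finset.mem_insert, Finset.mem_singleton, not_or] at hq hqa
      exact flipBit_update hqa
        (fun x b => by simp only [indepOf_bit hq.1 x b, indepOf_bit hq.2 x b]) x b
    · intro q hq hqa x b
      simp only [Finset.mem_insert, Finset.mem_singleton, not_or] at hq hqa
      simp only [indepOf_bit hq.1 x b, indepOf_bit hq.2 x b, indepOf_bit hqa x b]
    · intro x
      rw [flipBit_apply_self, allOn_insert, allOn_singleton]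
  · intro x b; simp only [indepOf_bit hc.symm x b, indepOf_bit hc'.symm x b]
  · intro x b; simp only [indepOf_bit hc.symm x b]

/-- Inside the basis change on `a'` controlled by `c`, a `Z` controlled by `a` is applied both
before and after the ladder. The unknown content of `a` enters twice and cancels; what remains is
the increment `allOn S`. Two controlled `Z` and two basis changes account for the four CNOTs. -/
theorem Ladder.step_dirty {S A : Finset Q} {F : (Q → Bool) → (Q → Bool)} {φ : (Q → Bool) → ℂ}
    {k : ℕ} (h : Ladder S A F φ k) {a c a' : Q} (ha : a ∈ A)
    (hF : ∀ x, F x a = xor (x a) (allOn S x)) (hcA : c ∉ A) (hca : c ≠ a')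
    (haS : a' ∉ S) (haA : a' ∉ A) :
    ∃ F' φ', Ladder (insert c S) (insert a' A) F' φ' (k + 4) ∧
      ∀ x, F' x a' = xor (x a') (allOn (insert c S) x) := by
  have haa : a ≠ a' := by rintro rfl; exact haA ha
  have h1 := Cost.mux_mul (t := a') (fun x b => by simp only [indepOf_bit hca.symm x b])
    (cost_ctrlBasis_conjTranspose c a' hca) (cost_cz a a' haa)
  have h2 := Cost.mux_mul (t := a') (fun x b => by simp only [indepOf_bit haa.symm x b])
    (cost_cz a a' haa) (cost_ctrlBasis c a' hca)
  have h3 := (h1.mul h.cost).mul h2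
  rw [mux_mul_mono a' a' F φ _ (h.upd a' haS haA) (h.phase a' haS haA), Matrix.mul_assoc,
    mux_mul_mux _ _ _ ?_] at h3
  · have e : (fun x => (ctrlBasis (F x c))ᴴ * zPow (F x a) * (zPow (x a) * ctrlBasis (x c))) =
        fun x => (ctrlBasis (x c))ᴴ * ((1 : ℂ) • zPow (allOn S x)) * ctrlBasis (x c) := by
      funext x
      rw [← Matrix.mul_assoc, Matrix.mul_assoc _ (zPow _) (zPow _), zPow_mul, h.fix x c hcA, hF,
        one_smul]
      congr 3
      cases x a <;> cases allOn S x <;> rfl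
    rw [e, mux_relPhase a' (fun _ => 1) (fun x => x c) (allOn S), mono_mul_mono] at h3
    refine ⟨_, _, ⟨h3.le (by omega), ?_, ?_, ?_⟩, ?_⟩
    · intro x q hq
      simp only [Finset.mem_insert, not_or] at hq
      rw [Function.comp_apply, h.fix _ q hq.2, flipBit_apply_ne hq.1]
    · intro q hq hqa x b
      simp only [Finset.mem_insert, not_or] at hq hqa
      rw [Function.comp_apply, flipBit_update hqa.1
        (fun x b => by simp only [indepOf_bit hq.1 x b, allOn_update hq.2 x b]), h.upd q hq.2 hqa.2,
        Function.comp_apply]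
    · intro q hq hqa x b
      simp only [Finset.mem_insert, not_or] at hq hqa
      dsimp only
      rw [flipBit_update hqa.1
        (fun x b => by simp only [indepOf_bit hq.1 x b, allOn_update hq.2 x b]),
        h.phase q hq.2 hqa.2]
      simp only [indepOf_bit hq.1 x b, allOn_update hq.2 x b, indepOf_bit hqa.1 x b]
    · intro x
      rw [Function.comp_apply, h.fix _ _ haA, flipBit_apply_self, allOn_insert]
  · intro x b
    dsimp only
    rw [h.upd a' haS haA]
    simp only [indepOf_bit hca.symm (F x) b, indepOf_bit haa.symm (F x) b]

theorem exists_ladder_dirty (j : ℕ) : ∀ S A : Finset Q, S.card = j + 2 → A.card = j + 1 →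
    Disjoint S A → ∃ a F φ, a ∈ A ∧ Ladder S A F φ (4 * j + 3) ∧
      ∀ x, F x a = xor (x a) (allOn S x) := by
  induction j with
  | zero =>
    intro S A hS hA hSA
    obtain ⟨c, c', -, rfl⟩ := Finset.card_eq_two.1 hS
    obtain ⟨a, rfl⟩ := Finset.card_eq_one.1 hA
    simp only [Finset.disjoint_singleton_right, Finset.mem_insert, Finset.mem_singleton,
      not_or] at hSA
    obtain ⟨F, φ, h, h'⟩ := ladder_pair (Ne.symm hSA.1) (Ne.symm hSA.2)
    exact ⟨a, F, φ, by simp, h, h'⟩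
  | succ j ih =>
    intro S A hS hA hSA
    obtain ⟨c, S, hcS, rfl, hS'⟩ := Finset.card_eq_succ.1 hS
    obtain ⟨a', A, haA, rfl, hA'⟩ := Finset.card_eq_succ.1 hA
    have hd : ∀ p ∈ insert c S, ¬ (p = a' ∨ p ∈ A) := fun p hp => by
      simpa using Finset.disjoint_left.1 hSA hp
    have hc := not_or.1 (hd c (by simp))
    obtain ⟨a, F, φ, ha, h, h'⟩ := ih S A hS' hA'
      (hSA.mono (Finset.subset_insert _ _) (Finset.subset_insert _ _))
    obtain ⟨F', φ', h1, h2⟩ := h.step_dirty ha h' hc.2 hc.1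
      (fun h => hd a' (by simp [h]) (.inl rfl)) haA
    exact ⟨a', F', φ', by simp, h1.mono_cost (by omega), h2⟩

/-- A NOT gate with `k` controls costs at most `8 k - 6` CNOTs with `k - 2` dirty ancillas. -/
theorem cost_mcx_dirty (S A : Finset Q) (t : Q) (hS : S.Nonempty) (htS : t ∉ S) (htA : t ∉ A)
    (hSA : Disjoint S A) (hcard : S.card ≤ A.card + 2) : Cost (mcx S t) (8 * S.card - 6) := by
  obtain h | h := Nat.lt_or_ge S.card 3
  · refine (cost_mcx_pow S t htS).le ?_
    have := hS.card_pos
    interval_cases S.card <;> simp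
  · obtain ⟨A', hA', hA'c⟩ := Finset.exists_subset_card_eq (s := A) (n := S.card - 2) (by omega)
    obtain ⟨c, S', hcS, rfl, hS'⟩ := Finset.card_eq_succ.1 (show S.card = (S.card - 1) + 1 by omega)
    rw [Finset.card_insert_of_notMem hcS] at *
    have hd : Disjoint (insert c S') A' := hSA.mono_right hA'
    simp only [Finset.disjoint_insert_left, Finset.mem_insert, not_or] at hd htS
    -- One control `c` stays out of the ladder. A Toffoli from `a` and `c` to `t` is applied once
    -- plainly and once inside the ladder, so the dirty value of `a` cancels and `x c && allOn S' x`
    -- survives.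
    obtain ⟨a, F, φ, ha, hL, hF⟩ := exists_ladder_dirty (S'.card - 2) S' A' (by omega) (by omega)
      hd.2
    have hat : a ≠ t := by rintro rfl; exact htA (hA' ha)
    have hac : a ≠ c := by rintro rfl; exact hd.1 ha
    have hT := cost_toffoli a c t hac hat (Ne.symm htS.1)
    have h2 := hL.conj htS.2 (fun h => htA (hA' h)) hT
    refine Cost.le ?_ (c := 2 * (4 * (S'.card - 2) + 3) + 6 + 6) (by omega)
    convert Cost.mux_mul ?_ h2 hT using 1
    · rw [mcx]
      congr 1
      funext x
      rw [notPow_mul, hL.fix x c hd.1, hF, allOn_insert]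
      cases x a <;> cases allOn S' x <;> cases x c <;> rfl
    · intro x b
      dsimp only
      rw [hL.upd t htS.2 fun h => htA (hA' h)]
      simp only [indepOf_bit hat.symm (F x) b, indepOf_bit htS.1 (F x) b]

theorem ladder_mcx {S : Finset Q} {q : Q} {c : ℕ} (h : Cost (mcx S q) c) :
    Ladder S {q} (flipBit q (allOn S)) (fun _ => 1) c where
  cost := by rwa [mcx, mux_notPow] at h
  fix x p hp := flipBit_apply_ne (by simpa using hp) _ _
  upd p hp hpq x b := flipBit_update (by simpa using hpq) (allOn_update hp) _ _
  phase _ _ _ _ _ := rfl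

/-- A NOT gate with `k` controls costs at most `16 k` CNOTs with one dirty ancilla. -/
theorem cost_mcx_one_dirty (S : Finset Q) (t q : Q) (htS : t ∉ S) (hqS : q ∉ S) (hqt : q ≠ t) :
    Cost (mcx S t) (16 * S.card) := by
  obtain h | h := Nat.eq_zero_or_pos S.card
  · rw [Finset.card_eq_zero.1 h]
    exact (cost_mcx_pow ∅ t (by simp)).le (by simp)
  obtain ⟨S₁, hS₁, hc₁⟩ := Finset.exists_subset_card_eq (s := S) (n := (S.card + 1) / 2) (by omega)
  set S₂ := S \ S₁ with hS₂
  have hc₂ : S₂.card + S₁.card = S.card := by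
    rw [hS₂, Finset.card_sdiff_add_card_eq_card hS₁]
  have hd : Disjoint S₁ S₂ := Finset.disjoint_sdiff
  have hq₁ : q ∉ S₁ := fun h => hqS (hS₁ h)
  have hq₂ : q ∉ S₂ := fun h => hqS (Finset.sdiff_subset h)
  have ht₁ : t ∉ S₁ := fun h => htS (hS₁ h)
  have ht₂ : t ∉ S₂ := fun h => htS (Finset.sdiff_subset h)
  -- The controls are halved with `q` as intermediate target, and each half borrows the qubits of
  -- the other as dirty ancillas. Alternating the two gates, two of each, cancels the unknown value
  -- of `q`.
  have h1 := cost_mcx_dirty S₁ (insert t S₂) q (Finset.card_pos.1 (by omega)) hq₁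
    (by simp [hq₂, hqt]) (by simp [ht₁, hd]) (by rw [Finset.card_insert_of_notMem ht₂]; omega)
  have h2 := cost_mcx_dirty (insert q S₂) S₁ t (by simp) (by simp [ht₂, hqt.symm]) ht₁
    (by simp [hq₁, hd.symm]) (by rw [Finset.card_insert_of_notMem hq₂]; omega)
  rw [Finset.card_insert_of_notMem hq₂] at h2
  have h3 := (ladder_mcx h1).conj ht₁ (by simpa using hqt.symm) h2
  refine Cost.le (c := (2 * (8 * S₁.card - 6) + (8 * (S₂.card + 1) - 6)) +
    (8 * (S₂.card + 1) - 6)) ?_ (by omega)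
  convert Cost.mux_mul ?_ h3 h2 using 1
  · rw [mcx]
    congr 1
    funext x
    have e : allOn S₂ (flipBit q (allOn S₁) x) = allOn S₂ x :=
      allOn_congr fun p hp => flipBit_apply_ne (by rintro rfl; exact hq₂ hp) _ _
    rw [notPow_mul, allOn_insert, allOn_insert, flipBit_apply_self, e,
      ← Finset.union_sdiff_of_subset hS₁, allOn_union]
    cases x q <;> cases allOn S₁ x <;> cases allOn S₂ x <;> simp_all
  · intro x b
    dsimp only
    rw [flipBit_update hqt.symm (allOn_update ht₁),
      allOn_update (by simp [ht₂, hqt.symm] : t ∉ insert q S₂)]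

/-- The relative-phase gate with three controls costs six CNOTs. -/
theorem cost_relPhase_three {c c' a t : Q} (hc : c ≠ t) (hc' : c' ≠ t) (ha : a ≠ t) (hca : c' ≠ a) :
    ∃ ω : (Q → Bool) → ℂ, (∀ q, q ≠ c' → q ≠ a → IndepOf q ω) ∧
      Cost (mono (flipBit t fun x => x c && (x c' && x a))
        fun x => ω x * relPhase (x c) (x c' && x a) (x t)) 6 := by
  -- `rotZ (-(π / 2))` is `-i Z`, so a two-control multiplexed rotation with four CNOTs replaces the
  -- doubly controlled `Z`; the stray phase becomes `ω`.
  have h1 := isRot_rotZ.cost_mux t {c', a} (by simp [hc'.symm, ha.symm])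
    (fun x => if x c' && x a then -(Real.pi / 2) else 0) (fun x y h => by
      have h1 := h c' (by simp)
      have h2 := h a (by simp)
      simp only [h1, h2])
  rw [Finset.card_pair hca] at h1
  refine ⟨fun x => if x c' && x a then -Complex.I else 1, ?_, ?_⟩
  · intro q h1 h2 x b
    simp only [indepOf_bit h1 x b, indepOf_bit h2 x b]
  · rw [← mux_relPhase]
    refine Cost.le (c := 1 + 4 + 1) ?_ (by norm_num)
    refine Cost.mux_mul ?_ (Cost.mux_mul ?_ (cost_ctrlBasis_conjTranspose c t hc) ?_)
      (cost_ctrlBasis c t hc)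
    · intro x b
      simp only [indepOf_bit hc.symm x b, indepOf_bit hc'.symm x b, indepOf_bit ha.symm x b]
    · intro x b; simp only [indepOf_bit hc.symm x b]
    · rw [if_neg (by norm_num), show 2 ^ 2 = 4 by norm_num] at h1
      convert h1 using 3 with x
      cases x c' && x a
      · simp [isRot_rotZ.zero, zPow_false]
      · ext i j
        have e : Complex.exp (-(Real.pi / 2 * Complex.I)) = -Complex.I := by
          rw [Complex.exp_neg, Complex.exp_pi_div_two_mul_I, Complex.inv_I]
        cases i <;> cases j <;>
          simp [rotZ, zPow, Complex.exp_pi_div_two_mul_I, e]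

/-- With clean ancillas `a` holds `allOn S` itself, so no cancellation is needed, and one
three-control relative-phase gate onto the fresh `a'` absorbs two new controls. -/
theorem Ladder.step_clean {S A : Finset Q} {F : (Q → Bool) → (Q → Bool)} {φ : (Q → Bool) → ℂ}
    {k : ℕ} (h : Ladder S A F φ k) {a c c' a' : Q} (ha : a ∈ S ∪ A)
    (hF : ∀ x, (∀ q ∈ A, x q = false) → F x a = allOn S x) (hcA : c ∉ A) (hcA' : c' ∉ A)
    (hca : c ≠ a') (hca' : c' ≠ a') (hcS : c' ∉ S) (haS : a' ∉ S) (haA : a' ∉ A) :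
    ∃ F' φ', Ladder (insert c (insert c' S)) (insert a' A) F' φ' (k + 6) ∧
      ∀ x, (∀ q ∈ insert a' A, x q = false) → F' x a' = allOn (insert c (insert c' S)) x := by
  have haa : a ≠ a' := by
    rintro rfl; simp [haS, haA] at ha
  have hac : c' ≠ a := by
    rintro rfl; simp [hcS, hcA'] at ha
  obtain ⟨ω, hω, hG⟩ := cost_relPhase_three hca hca' haa hac
  have h3 := hG.mul h.cost
  rw [mono_mul_mono] at h3
  have hne : ∀ q, q ∉ S → q ∉ A → q ≠ a := by
    rintro q h1 h2 rfl; simp [h1, h2] at ha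
  refine ⟨_, _, ⟨h3.le (by omega), ?_, ?_, ?_⟩, ?_⟩
  · intro x q hq
    simp only [Finset.mem_insert, not_or] at hq
    rw [Function.comp_apply, flipBit_apply_ne hq.1, h.fix _ q hq.2]
  · intro q hq hqa x b
    simp only [Finset.mem_insert, not_or] at hq hqa
    have hqa' := hne q hq.2.2 hqa.2
    rw [Function.comp_apply, h.upd q hq.2.2 hqa.2, flipBit_update hqa.1, Function.comp_apply]
    intro x b
    simp only [indepOf_bit hq.1 x b, indepOf_bit hq.2.1 x b, indepOf_bit hqa' x b]
  · intro q hq hqa x b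
    simp only [Finset.mem_insert, not_or] at hq hqa
    have hqa' := hne q hq.2.2 hqa.2
    dsimp only
    rw [h.upd q hq.2.2 hqa.2, h.phase q hq.2.2 hqa.2, hω q hq.2.1 hqa']
    simp only [indepOf_bit hq.1 (F x) b, indepOf_bit hq.2.1 (F x) b, indepOf_bit hqa' (F x) b,
      indepOf_bit hqa.1 (F x) b]
  · intro x hx
    simp only [Finset.mem_insert, forall_eq_or_imp] at hx
    rw [Function.comp_apply, flipBit_apply_self, h.fix _ _ haA, h.fix _ _ hcA, h.fix _ _ hcA', hF x hx.2,
      hx.1, Bool.false_xor, allOn_insert, allOn_insert]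

/-- The ladder starts with a single control serving as its own output, whence the odd number of
controls and `a ∈ S ∪ A`. -/
theorem exists_ladder_clean (j : ℕ) : ∀ S A : Finset Q, S.card = 2 * j + 1 → A.card = j →
    Disjoint S A → ∃ a F φ, a ∈ S ∪ A ∧ Ladder S A F φ (6 * j) ∧
      ∀ x, (∀ q ∈ A, x q = false) → F x a = allOn S x := by
  induction j with
  | zero =>
    intro S A hS hA hSA
    obtain ⟨c, rfl⟩ := Finset.card_eq_one.1 hS
    obtain rfl := Finset.card_eq_zero.1 hA
    refine ⟨c, id, fun _ => 1, by simp, ⟨?_, ?_, ?_, ?_⟩, ?_⟩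
    · rw [mono_id_one]; exact Cost.one
    · intro x q _; rfl
    · intro q _ _ x b; rfl
    · intro q _ _ x b; rfl
    · intro x _; rw [allOn_singleton]; rfl
  | succ j ih =>
    intro S A hS hA hSA
    obtain ⟨c, S, hcS, rfl, hS'⟩ := Finset.card_eq_succ.1 (show S.card = (2 * j + 2) + 1 by omega)
    obtain ⟨c', S, hcS', rfl, hS''⟩ := Finset.card_eq_succ.1 hS'
    obtain ⟨a', A, haA, rfl, hA'⟩ := Finset.card_eq_succ.1 hA
    have hd : ∀ p ∈ insert c (insert c' S), ¬ (p = a' ∨ p ∈ A) := fun p hp => by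
      simpa using Finset.disjoint_left.1 hSA hp
    have hc := not_or.1 (hd c (by simp))
    have hc' := not_or.1 (hd c' (by simp))
    obtain ⟨a, F, φ, ha, h, h'⟩ := ih S A hS'' hA'
      (hSA.mono (fun p hp => by simp [hp]) (Finset.subset_insert _ _))
    obtain ⟨F', φ', h1, h2⟩ := h.step_clean ha h' hc.2 hc'.2 hc.1 hc'.1 hcS'
      (fun h => hd a' (by simp [h]) (.inl rfl)) haA
    exact ⟨a', F', φ', by simp, h1.mono_cost (by omega), h2⟩

end

/-! ### Operators on a register with ancillas -/

/-- The embedding of the states of `n` qubits into the states of the register, with clean ancillas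
in the state `|0⟩` and dirty ancillas in the basis state `d`. -/
def embed (n a b : ℕ) (d : Fin b → Bool) : Matrix (Register n a b → Bool) (Fin n → Bool) ℂ :=
  mono (fun y => basisState y (fun _ => false) d) fun _ => 1

/-- The operator `A` is implemented by a circuit with `a` clean and `b` dirty ancillas and at most
`c` CNOTs. -/
def Realizable (a b : ℕ) {n : ℕ} (A : Matrix (Fin n → Bool) (Fin n → Bool) ℂ) (c : ℕ) : Prop :=
  ∃ C : Circuit (Register n a b),
    (∀ d, C.toMatrix * embed n a b d = embed n a b d * A) ∧ C.cnotCount ≤ c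

theorem exists_eq_basisState {n a b : ℕ} (w : Register n a b → Bool) :
    ∃ y z e, w = basisState y z e :=
  ⟨fun i => w (.inl i), fun i => w (.inr (.inl i)), fun i => w (.inr (.inr i)), by
    funext i; rcases i with i | i | i <;> rfl⟩

theorem basisState_inj {n a b : ℕ} {y y' : Fin n → Bool} {z z' : Fin a → Bool} {e e' : Fin b → Bool} :
    basisState y z e = basisState y' z' e' ↔ y = y' ∧ z = z' ∧ e = e' := by
  constructor
  · intro h
    refine ⟨?_, ?_, ?_⟩ <;> funext i
    · exact congrFun h (.inl i)
    · exact congrFun h (.inr (.inl i))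
    · exact congrFun h (.inr (.inr i))
  · rintro ⟨rfl, rfl, rfl⟩; rfl

theorem basisState_update {n a b : ℕ} (y : Fin n → Bool) (z : Fin a → Bool) (e : Fin b → Bool)
    (t : Fin n) (v : Bool) :
    basisState (update y t v) z e = update (basisState y z e) (.inl t) v :=
  (Sum.update_elim_inl (f := y) (g := Sum.elim z e) (i := t) (x := v)).symm

theorem embed_mul_apply {n m a b : ℕ} (d : Fin b → Bool)
    (A : Matrix (Fin n → Bool) (Fin m → Bool) ℂ) (y : Fin n → Bool) (z : Fin a → Bool)
    (e : Fin b → Bool) (x : Fin m → Bool) :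
    (embed n a b d * A) (basisState y z e) x =
      if z = (fun _ => false) ∧ e = d then A y x else 0 := by
  rw [Matrix.mul_apply, Finset.sum_eq_single y]
  · simp [embed, mono, basisState_inj]
  · intro y' _ hy
    simp [embed, mono, basisState_inj, hy.symm]
  · simp

theorem embed_conjTranspose_mul {n a b : ℕ} (d : Fin b → Bool) :
    (embed n a b d)ᴴ * embed n a b d = 1 := by
  ext y x
  rw [embed, mul_mono_apply, Matrix.conjTranspose_apply]
  simp only [mono, Matrix.of_apply, basisState_inj, and_true, mul_one, Matrix.one_apply]
  by_cases h : x = y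
  · simp [h]
  · simp [h, Ne.symm h]

theorem implements_iff {n m a b : ℕ} (C : Circuit (Register n a b))
    (A : Matrix (Fin n → Bool) (Fin m → Bool) ℂ) :
    Implements C A ↔ ∀ d, C.toMatrix * embed n a b d * stdIsometry n m = embed n a b d * A := by
  have h : ∀ d, C.toMatrix * embed n a b d * stdIsometry n m =
      C.toMatrix * (mono (fun x => basisState (pad n x) (fun _ => false) d) fun _ => 1 :
        Matrix (Register n a b → Bool) (Fin m → Bool) ℂ) := by
    intro d
    rw [Matrix.mul_assoc]
    congr 1
    exact (mono_mul_mono _ _ (pad n) (fun _ => 1)).trans (by simp; rfl)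
  constructor
  · intro hC d
    ext w x
    obtain ⟨y, z, e, rfl⟩ := exists_eq_basisState w
    rw [h, mul_mono_apply, mul_one, embed_mul_apply]
    exact hC x d y z e
  · intro hC x d y z e
    have := congrFun (congrFun (hC d) (basisState y z e)) x
    rwa [h, mul_mono_apply, mul_one, embed_mul_apply] at this

theorem pad_self {n : ℕ} (x : Fin n → Bool) : pad n x = x := by
  funext i; simp [pad]

theorem stdIsometry_self (n : ℕ) : stdIsometry n n = 1 := by
  ext y x; simp [stdIsometry, pad_self, Matrix.one_apply]

section

variable {a b n : ℕ} {A B : Matrix (Fin n → Bool) (Fin n → Bool) ℂ} {c c' : ℕ}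

theorem realizable_iff :
    Realizable a b A c ↔ ∃ C : Circuit (Register n a b), Implements C A ∧ C.cnotCount ≤ c := by
  simp only [Realizable, implements_iff, stdIsometry_self, Matrix.mul_one]

theorem Realizable.le (h : Realizable a b A c) (hc : c ≤ c') : Realizable a b A c' := by
  obtain ⟨C, h1, h2⟩ := h
  exact ⟨C, h1, h2.trans hc⟩

theorem Realizable.one : Realizable a b (1 : Matrix (Fin n → Bool) (Fin n → Bool) ℂ) 0 :=
  ⟨[], fun d => by simp [Circuit.toMatrix], le_rfl⟩

theorem Realizable.mul (hA : Realizable a b A c) (hB : Realizable a b B c') :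
    Realizable a b (A * B) (c + c') := by
  obtain ⟨C, h1, h2⟩ := hA
  obtain ⟨D, h3, h4⟩ := hB
  refine ⟨D ++ C, fun d => ?_, by rw [Circuit.cnotCount_append]; omega⟩
  rw [Circuit.toMatrix_append, Matrix.mul_assoc, h3, ← Matrix.mul_assoc, h1, Matrix.mul_assoc]

/-- The embedding `E` is an isometry and the circuit is unitary, so `E * A`, and with it `A`, is an
isometry. -/
theorem Realizable.conjTranspose_mul (hA : Realizable a b A c) : Aᴴ * A = 1 := by
  obtain ⟨C, h1, -⟩ := hA
  have hE := embed_conjTranspose_mul (n := n) (a := a) (b := b) fun _ => false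
  have h1 := h1 fun _ => false
  generalize embed n a b (fun _ => false) = E at hE h1
  have hC : (Circuit.toMatrix C)ᴴ * Circuit.toMatrix C = 1 :=
    mul_eq_one_comm.1 (Circuit.mul_conjTranspose C)
  calc Aᴴ * A = (E * A)ᴴ * (E * A) := by
        rw [Matrix.conjTranspose_mul, Matrix.mul_assoc, ← Matrix.mul_assoc Eᴴ, hE, Matrix.one_mul]
    _ = Eᴴ * (((Circuit.toMatrix C)ᴴ * Circuit.toMatrix C) * E) := by
        rw [← h1, Matrix.conjTranspose_mul]; simp only [Matrix.mul_assoc]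
    _ = 1 := by rw [hC, Matrix.one_mul, hE]

theorem Realizable.mul_conjTranspose (hA : Realizable a b A c) : A * Aᴴ = 1 :=
  mul_eq_one_comm.1 hA.conjTranspose_mul

theorem Realizable.inv (hA : Realizable a b A c) : Realizable a b Aᴴ c := by
  have hu := hA.mul_conjTranspose
  obtain ⟨C, h1, h2⟩ := hA
  refine ⟨Circuit.inv C, fun d => ?_, by rwa [Circuit.cnotCount_inv]⟩
  have hC : (Circuit.toMatrix C)ᴴ * Circuit.toMatrix C = 1 :=
    mul_eq_one_comm.1 (Circuit.mul_conjTranspose C)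
  rw [Circuit.toMatrix_inv]
  calc (Circuit.toMatrix C)ᴴ * embed n a b d
      = (Circuit.toMatrix C)ᴴ * (embed n a b d * A) * Aᴴ := by
        rw [Matrix.mul_assoc, Matrix.mul_assoc, hu, Matrix.mul_one]
    _ = embed n a b d * Aᴴ := by
        rw [← h1, ← Matrix.mul_assoc, hC, Matrix.one_mul]

theorem mux_mul_embed {t : Fin n} {U : (Register n a b → Bool) → Matrix Bool Bool ℂ}
    {U' : (Fin n → Bool) → Matrix Bool Bool ℂ} (d : Fin b → Bool)
    (hU : ∀ y, U (basisState y (fun _ => false) d) = U' y) :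
    mux (Sum.inl t) U * embed n a b d = embed n a b d * mux t U' := by
  rw [embed, mux_mul_mono (.inl t) t _ _ U (fun x v => basisState_update x _ d t v)
    fun _ _ => rfl]
  simp only [hU]

/-- Multiplexed operators on the register that act as multiplexed operators on the `n` qubits. -/
theorem Realizable.of_mux {t : Fin n} {U : (Register n a b → Bool) → Matrix Bool Bool ℂ}
    {U' : (Fin n → Bool) → Matrix Bool Bool ℂ} (h : Cost (mux (Sum.inl t) U) c)
    (hU : ∀ y d, U (basisState y (fun _ => false) d) = U' y) : Realizable a b (mux t U') c := by
  obtain ⟨C, h1, h2⟩ := h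
  exact ⟨C, fun d => by rw [h1, mux_mul_embed d fun y => hU y d], h2⟩

/-- Renaming of the qubits of a gate. -/
def Gate.map {Q Q' : Type} (f : Q ↪ Q') : Gate Q → Gate Q'
  | .single q U => .single (f q) U
  | .cnot c t h => .cnot (f c) (f t) (f.injective.ne h)

theorem cnotCount_map {Q Q' : Type} (f : Q ↪ Q') (C : Circuit Q) :
    Circuit.cnotCount (List.map (Gate.map f) C) = C.cnotCount := by
  induction C with
  | nil => rfl
  | cons g gs ih => cases g <;> simp [Gate.map, Circuit.cnotCount, ih]

theorem toMatrix_map_mul_embed (C : Circuit (Fin n)) (d : Fin b → Bool) :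
    Circuit.toMatrix (List.map (Gate.map (Function.Embedding.inl (β := Fin a ⊕ Fin b))) C) *
      embed n a b d =
      embed n a b d * C.toMatrix := by
  induction C with
  | nil => simp [Circuit.toMatrix]
  | cons g gs ih =>
    have : (Gate.map (Function.Embedding.inl (β := Fin a ⊕ Fin b)) g).toMatrix * embed n a b d =
        embed n a b d * g.toMatrix := by
      cases g with
      | single q U =>
        rw [Gate.map, Gate.toMatrix_single, Gate.toMatrix_single]
        exact mux_mul_embed d fun _ => rfl
      | cnot c t h =>
        rw [Gate.map, Gate.toMatrix_cnot, Gate.toMatrix_cnot]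
        exact mux_mul_embed d fun _ => rfl
    rw [List.map_cons, Circuit.toMatrix, Circuit.toMatrix, Matrix.mul_assoc, this,
      ← Matrix.mul_assoc, ih, Matrix.mul_assoc]

theorem Realizable.of_cost (h : Cost A c) : Realizable a b A c := by
  obtain ⟨C, rfl, h2⟩ := h
  exact ⟨_, toMatrix_map_mul_embed C, by rwa [cnotCount_map]⟩

/-- All multi-controlled NOT gates on `n` qubits cost at most `c` CNOTs. -/
def HasMcx (a b n c : ℕ) : Prop :=
  ∀ (S : Finset (Fin n)) (t : Fin n), t ∉ S → Realizable a b (mcx S t) c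

/-- Only finiteness matters here: it provides some circuit for `W` with any ancillas, as required
when the bound of the first claim is infinite. -/
theorem hasMcx_pow (a b n : ℕ) : HasMcx a b n (2 ^ (n + 1)) := fun S t ht =>
  (Realizable.of_cost (cost_mcx_pow S t ht)).le <| by
    have : S.card ≤ n := by simpa using S.card_le_univ
    have : 2 ^ (S.card + 1) ≤ 2 ^ (n + 1) := Nat.pow_le_pow_right (by norm_num) (by omega)
    exact (Nat.sub_le _ _).trans this

theorem allOn_map_inl (S : Finset (Fin n)) (y : Fin n → Bool) (z : Fin a → Bool)
    (e : Fin b → Bool) : allOn (S.map Function.Embedding.inl) (basisState y z e) = allOn S y := by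
  rw [Bool.eq_iff_iff]
  simp [allOn, basisState]

theorem card_lt_of_notMem {S : Finset (Fin (n + 1))} {t : Fin (n + 1)} (h : t ∉ S) :
    S.card ≤ n := by
  have := (insert t S).card_le_univ
  rw [Finset.card_insert_of_notMem h] at this
  simpa using this

theorem hasMcx_one_dirty (n : ℕ) : HasMcx 0 1 (n + 1) (16 * n) := fun S t ht => by
  have h := cost_mcx_one_dirty (S.map Function.Embedding.inl : Finset (Register (n + 1) 0 1))
    (.inl t) (.inr (.inr 0)) (by simpa using ht) (by simp) (by simp)
  rw [Finset.card_map] at h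
  exact (Realizable.of_mux h fun y d => by rw [allOn_map_inl]).le
    (Nat.mul_le_mul_left _ (card_lt_of_notMem ht))

/-- A ladder on `2 j + 1` of the `k` controls is computed and undone around a CNOT if `k` is odd, or
around a Toffoli with the leftover control if `k` is even. This costs `12 j + 1 = 6 k - 5` or `12 j
+ 6 = 6 k - 6`, with `j = (k - 1) / 2 ≤ a`. -/
theorem hasMcx_clean (n a : ℕ) (hn : 1 ≤ n) (ha : n ≤ 2 * a + 2) :
    HasMcx a 0 (n + 1) (6 * n - 5) := fun S t ht => by
  have hSn := card_lt_of_notMem ht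
  obtain h0 | h0 := Nat.eq_zero_or_pos S.card
  · rw [Finset.card_eq_zero.1 h0]
    exact (Realizable.of_cost (cost_mcx_pow ∅ t (by simp))).le (by simp)
  set j := (S.card - 1) / 2 with hj
  set anc : Finset (Register (n + 1) a 0) :=
    Finset.univ.map (Function.Embedding.inl.trans Function.Embedding.inr) with hanc
  obtain ⟨A, hA, hAc⟩ := Finset.exists_subset_card_eq (s := anc) (n := j) (by
    rw [hanc, Finset.card_map, Finset.card_univ, Fintype.card_fin]; omega)
  have hA0 : ∀ (y : Fin (n + 1) → Bool) (d : Fin 0 → Bool), ∀ q ∈ A,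
      (basisState y (fun _ => false) d : Register (n + 1) a 0 → Bool) q = false := by
    intro y d q hq
    have := hA hq
    simp only [hanc, Finset.mem_map, Finset.mem_univ, true_and] at this
    obtain ⟨i, rfl⟩ := this
    rfl
  have hAl : ∀ p : Fin (n + 1), (Sum.inl p : Register (n + 1) a 0) ∉ A := by
    intro p hp
    have := hA hp
    simp [hanc] at this
  obtain ⟨S', hS', hSc⟩ := Finset.exists_subset_card_eq (s := S) (n := 2 * j + 1) (by omega)
  obtain ⟨q, F, φ, hq, hL, hF⟩ := exists_ladder_clean j
    (S'.map Function.Embedding.inl : Finset (Register (n + 1) a 0)) A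
    (by rw [Finset.card_map, hSc]) hAc (by
      rw [Finset.disjoint_left]
      intro p hp
      obtain ⟨p, -, rfl⟩ := Finset.mem_map.1 hp
      exact hAl p)
  have htS' : t ∉ S' := fun h => ht (hS' h)
  have htS'' : (Sum.inl t : Register (n + 1) a 0) ∉ S'.map Function.Embedding.inl := by
    simpa using htS'
  have hqt : q ≠ .inl t := by
    rintro rfl
    simp only [Finset.mem_union, htS'', hAl t, or_self] at hq
  obtain h1 | h1 : S.card = 2 * j + 1 ∨ S.card = 2 * j + 2 := by omega
  · obtain rfl := Finset.eq_of_subset_of_card_le hS' (by omega)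
    have := hL.conj htS'' (hAl t) (Cost.cnot q _ hqt)
    exact (Realizable.of_mux this fun y d => by rw [hF _ (hA0 y d), allOn_map_inl]).le (by omega)
  · obtain ⟨c, hc⟩ := Finset.card_eq_one.1
      (show (S \ S').card = 1 by rw [Finset.card_sdiff_of_subset hS']; omega)
    have hcS : c ∈ S \ S' := by simp [hc]
    rw [Finset.mem_sdiff] at hcS
    have hqc : q ≠ .inl c := by
      rintro rfl
      simp [hAl c, hcS.2] at hq
    have hct : (Sum.inl c : Register (n + 1) a 0) ≠ .inl t := by
      rintro h
      rw [Sum.inl.injEq] at h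
      exact ht (h ▸ hcS.1)
    have hS : S = insert c S' := by
      rw [← Finset.union_sdiff_of_subset hS', hc, Finset.union_comm, Finset.insert_eq]
    have := hL.conj htS'' (hAl t) (cost_toffoli q (.inl c) _ hqc hqt hct)
    rw [mcx]
    exact (Realizable.of_mux this fun y d => by
      rw [hF _ (hA0 y d), allOn_map_inl, hS, allOn_insert, hL.fix _ _ (hAl c), Bool.and_comm]
      rfl).le (by omega)

end

/-! ### Permutation gates -/

section Masks

variable {Q : Type} [Fintype Q] [DecidableEq Q]

/-- Addition of the mask `p` on the qubits in `S` under the condition `g`. -/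
def maskOn (S : Finset Q) (p : Q → Bool) (g : (Q → Bool) → Bool) (x : Q → Bool) : Q → Bool :=
  fun i => if i ∈ S then xor (x i) (p i && g x) else x i

/-- The qubits in `S` are in the basis state `p`. -/
def matchOn (S : Finset Q) (p x : Q → Bool) : Bool := decide (∀ i ∈ S, x i = p i)

theorem cost_maskOn (S : Finset Q) (p : Q → Bool) (g : (Q → Bool) → Bool) (d : ℕ)
    (hg : ∀ q ∈ S, IndepOf q g) (hd : ∀ q ∈ S, Cost (mux q fun x => notPow (p q && g x)) d) :
    Cost (mono (maskOn S p g) fun _ => 1) (S.card * d) := by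
  induction S using Finset.induction_on with
  | empty =>
    have : maskOn ∅ p g = id := by funext x i; simp [maskOn]
    rw [this, mono_id_one]
    simpa using Cost.one
  | insert q S hq ih =>
    have h1 := hd q (by simp)
    have h2 := ih (fun q hq => hg q (by simp [hq])) (fun q hq => hd q (by simp [hq]))
    have h3 := h2.mul h1
    rw [mux_notPow, mono_mul_mono] at h3
    rw [Finset.card_insert_of_notMem hq]
    refine Cost.le (c := S.card * d + d) ?_ (by ring_nf; rfl)
    convert h3 using 1
    congr 1
    · funext x i
      simp only [maskOn, Function.comp_apply, Finset.mem_insert]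
      rw [flipBit, hg q (by simp)]
      by_cases hi : i = q
      · subst hi; simp [hq]
      · simp [hi]
    · simp

theorem cost_maskOn_true (S : Finset Q) (p : Q → Bool) :
    Cost (mono (maskOn S p fun _ => true) fun _ => 1) 0 := by
  have := cost_maskOn S p (fun _ => true) 0 (fun q _ x b => rfl) fun q _ =>
    Cost.single q _ (by rw [notPow_conjTranspose, notPow_mul_self])
  rwa [mul_zero] at this

theorem cost_maskOn_bit (S : Finset Q) (p : Q → Bool) (h : Q) (hS : h ∉ S) :
    Cost (mono (maskOn S p fun x => x h) fun _ => 1) S.card := by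
  have := cost_maskOn S p (fun x => x h) 1
    (fun q hq => indepOf_bit (by rintro rfl; exact hS hq)) fun q hq => by
      cases p q
      · simp only [Bool.false_and, notPow_false, mux_one]
        exact Cost.one.le (by norm_num)
      · simp only [Bool.true_and]
        exact Cost.cnot h q (by rintro rfl; exact hS hq)
  rwa [mul_one] at this

theorem maskOn_bit_involutive {Q : Type} [DecidableEq Q] (S : Finset Q) (p : Q → Bool) (h : Q) (hS : h ∉ S) :
    Function.Involutive (maskOn S p fun x => x h) := by
  intro x
  funext i
  by_cases hi : i ∈ S <;> simp [maskOn, hi, hS]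

end Masks

section

variable {a b n c : ℕ}

theorem Realizable.injective {f : (Fin n → Bool) → (Fin n → Bool)} {φ : (Fin n → Bool) → ℂ}
    (h : Realizable a b (mono f φ) c) : Function.Injective f := by
  intro x y hxy
  by_contra hne
  have h1 := h.conjTranspose_mul
  have hxx := congrFun (congrFun h1 x) x
  have hyx := congrFun (congrFun h1 y) x
  have hyy := congrFun (congrFun h1 y) y
  rw [mul_mono_apply, Matrix.conjTranspose_apply, mono, Matrix.of_apply, if_pos rfl,
    Matrix.one_apply_eq] at hxx
  rw [mul_mono_apply, Matrix.conjTranspose_apply, mono, Matrix.of_apply, if_pos hxy,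
    Matrix.one_apply_ne (Ne.symm hne)] at hyx
  rw [mul_mono_apply, Matrix.conjTranspose_apply, mono, Matrix.of_apply, if_pos rfl,
    Matrix.one_apply_eq] at hyy
  obtain h | h := mul_eq_zero.1 hyx
  · rw [h, zero_mul] at hyy; exact zero_ne_one hyy
  · rw [h, mul_zero] at hxx; exact zero_ne_one hxx

theorem HasMcx.pattern (hc : HasMcx a b n c) (S : Finset (Fin n)) (t : Fin n) (ht : t ∉ S)
    (p : Fin n → Bool) : Realizable a b (mono (flipBit t (matchOn S p)) fun _ => 1) c := by
  have h1 : Realizable a b (mono (maskOn S (fun i => !(p i)) fun _ => true) fun _ => 1) 0 :=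
    Realizable.of_cost (cost_maskOn_true S _)
  have h2 := hc S t ht
  rw [mcx, mux_notPow] at h2
  have h3 := (h1.mul h2).mul h1
  rw [mono_mul_mono, mono_mul_mono, zero_add, add_zero] at h3
  convert h3 using 1
  congr 1
  · funext x i
    have e : allOn S (maskOn S (fun i => !(p i)) (fun _ => true) x) =
        matchOn S p x := by
      rw [Bool.eq_iff_iff]
      simp only [allOn, matchOn, decide_eq_true_eq]
      refine forall₂_congr fun i hi => ?_
      simp only [maskOn, hi, if_true, Bool.and_true]
      cases x i <;> cases p i <;> simp
    simp only [Function.comp_apply]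
    rw [flipBit, flipBit, e]
    by_cases hi : i = t
    · subst hi; simp [maskOn, ht]
    · by_cases hS : i ∈ S <;> simp [maskOn, hi, hS]
  · simp

/-- The reflection about the state `|0⟩` costs as much as a multi-controlled NOT gate. -/
theorem HasMcx.reflection (hc : HasMcx a b (n + 1) c) :
    Realizable a b (mono id fun x : Fin (n + 1) → Bool =>
      if x = (fun _ => false) then -1 else 1) c := by
  set S : Finset (Fin (n + 1)) := Finset.univ.erase 0 with hS
  set p : Fin (n + 1) → Bool := fun _ => false with hp
  have h1 := hc.pattern S 0 (by simp [hS]) p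
  rw [← mux_notPow] at h1
  -- Conjugation by the rotation turns the controlled NOT into a controlled `Z`, and the outer NOT
  -- moves the sign from `|1⟩` to `|0⟩`.
  have hu : ∀ θ, notPow true * rotY θ * (notPow true * rotY θ)ᴴ = 1 := by
    intro θ
    rw [Matrix.conjTranspose_mul, Matrix.mul_assoc, ← Matrix.mul_assoc (rotY θ),
      isRot_rotY.mul_conj, Matrix.one_mul, notPow_conjTranspose, notPow_mul_self]
  have h2 := Realizable.of_cost (a := a) (b := b)
    (Cost.single (0 : Fin (n + 1)) _ (hu (-(Real.pi / 4))))
  have h3 := (h2.mul h1).mul h2.inv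
  have hm : IndepOf (0 : Fin (n + 1)) (matchOn S p) := by
    intro x b
    rw [matchOn, matchOn, decide_eq_decide]
    refine forall₂_congr fun i hi => ?_
    rw [update_of_ne (by rintro rfl; simp [hS] at hi)]
  have e : ∀ e : Bool, notPow true * rotY (-(Real.pi / 4)) * notPow e *
      (notPow true * rotY (-(Real.pi / 4)))ᴴ =
        Matrix.diagonal fun b => if e && !b then -1 else 1 := by
    intro e
    have h := isRot_rotY.add (-(Real.pi / 4)) (Real.pi / 4)
    rw [neg_add_cancel, isRot_rotY.zero] at h
    have h' : rotY (-(Real.pi / 4)) * notPow e * rotY (Real.pi / 4) = zPow e := by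
      rw [← rotY_mul_zPow_mul, ← Matrix.mul_assoc, ← Matrix.mul_assoc, ← h, Matrix.one_mul,
        Matrix.mul_assoc, ← h, Matrix.mul_one]
    rw [Matrix.conjTranspose_mul, notPow_conjTranspose, isRot_rotY.conj, neg_neg,
      ← Matrix.mul_assoc, Matrix.mul_assoc (notPow true), Matrix.mul_assoc (notPow true), h']
    ext i j
    rw [Matrix.mul_apply, Fintype.sum_bool, zPow, Matrix.mul_diagonal, Matrix.mul_diagonal]
    cases i <;> cases j <;> cases e <;> simp [notPow]
  rw [mux_conjTranspose _ _ fun _ _ => rfl, mux_mul_mux _ _ _ fun _ _ => rfl,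
    mux_mul_mux _ _ _ fun x b => by simp only [hm x b]] at h3
  simp only [e] at h3
  rw [mux_diagonal (0 : Fin (n + 1)) fun x b => if matchOn S p x && !b then -1 else 1] at h3
  refine Realizable.le (c := 0 + c + 0) ?_ (by simp)
  convert h3 using 5 with x
  simp only [matchOn, hp, hS, Finset.mem_erase, Finset.mem_univ, and_true, Bool.and_eq_true,
    decide_eq_true_eq, Bool.not_eq_true', funext_iff]
  constructor
  · intro h; exact ⟨fun i _ => h i, h 0⟩
  · rintro ⟨h, h0⟩ i
    by_cases hi : i = 0
    · rw [hi, h0]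
    · exact h i hi

/-- The basis states that vanish outside the first `s` qubits. -/
def InBlock (s : ℕ) (x : Fin n → Bool) : Prop := ∀ i : Fin n, s ≤ i → x i = false

/-- The first `s` qubits. -/
def low (n s : ℕ) : Finset (Fin n) := Finset.univ.filter fun i => (i : ℕ) < s

theorem mem_low {s : ℕ} {i : Fin n} : i ∈ low n s ↔ (i : ℕ) < s := by simp [low]

theorem card_low_le (n s : ℕ) : (low n s).card ≤ s := by
  have : (low n s).card ≤ (Finset.range s).card :=
    Finset.card_le_card_of_injOn (fun i => (i : ℕ)) (fun i hi => by simpa using mem_low.1 hi)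
      (Fin.val_injective.injOn)
  simpa using this

theorem pad_injective {m : ℕ} (h : m ≤ n) : Function.Injective (pad n : (Fin m → Bool) → _) := by
  intro x y hxy
  funext i
  have := congrFun hxy ⟨i, by omega⟩
  simpa [pad] using this

theorem inBlock_pad {s : ℕ} (x : Fin s → Bool) : InBlock s (pad n x) := fun i hi => by
  simp [pad, Nat.not_lt.2 hi]

/-- Each pivot brings one stray state `x` to a free place `y` of the block. CNOTs from a bit `h ≥ s`
with `x h = 1` make `x` agree with `y` except at `h`, and a NOT on `h` controlled by the first `s`
bits of `y` clears `h`. States of `T` already in the block have `h = 0` and differ from `y`, so they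
stay. Other strays may move anywhere; `U` only bounds their number. -/
theorem exists_pivot (hc : HasMcx a b (n + 1) c) (s : ℕ) (hs : s ≤ n + 1) (r : ℕ) :
    ∀ T : Finset (Fin (n + 1) → Bool), T.card ≤ 2 ^ s →
    ∀ U ⊆ T, U.card ≤ r → (∀ x ∈ T, x ∉ U → InBlock s x) →
    ∃ f : (Fin (n + 1) → Bool) → (Fin (n + 1) → Bool),
      Realizable a b (mono f fun _ => 1) (r * (n + c)) ∧ ∀ x ∈ T, InBlock s (f x) := by
  classical
  induction r with
  | zero =>
    intro T _ U _ hr hU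
    rw [Nat.le_zero, Finset.card_eq_zero] at hr
    subst hr
    exact ⟨id, by rw [mono_id_one]; simpa using Realizable.one, fun x hx => hU x hx (by simp)⟩
  | succ r ih =>
    intro T hT U hUT hr hU
    by_cases hB : ∀ x ∈ T, InBlock s x
    · exact ⟨id, by rw [mono_id_one]; exact Realizable.one.le (Nat.zero_le _), hB⟩
    push Not at hB
    obtain ⟨x, hxT, hx⟩ := hB
    have hxU : x ∈ U := by
      by_contra h
      exact hx (hU x hxT h)
    -- The block has `2 ^ s` states, while `T` has at most that many and one of them, `x`, lies
    -- outside.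
    obtain ⟨y, hyB, hyT⟩ : ∃ y, InBlock s y ∧ y ∉ T := by
      by_contra! h
      have h1 : (Finset.univ.image (pad (n + 1) : (Fin s → Bool) → _)) ⊆ T.erase x := by
        intro y hy
        obtain ⟨z, -, rfl⟩ := Finset.mem_image.1 hy
        refine Finset.mem_erase.2 ⟨?_, h _ (inBlock_pad z)⟩
        rintro rfl
        exact hx (inBlock_pad z)
      have h2 := Finset.card_le_card h1
      rw [Finset.card_image_of_injective _ (pad_injective hs), Finset.card_erase_of_mem hxT] at h2
      have h3 := Finset.card_pos.2 ⟨x, hxT⟩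
      simp at h2
      omega
    simp only [InBlock] at hx
    push Not at hx
    obtain ⟨h, hsh, hxh⟩ := hx
    replace hxh : x h = true := by simpa using hxh
    have hyh := hyB h hsh
    set p : Fin (n + 1) → Bool := fun i => xor (x i) (y i)
    set f₁ := maskOn (Finset.univ.erase h) p fun x => x h with hf₁
    set f₂ := flipBit h (matchOn (low (n + 1) s) y) with hf₂
    have h1 : Realizable a b (mono f₁ fun _ => 1) n := by
      have := cost_maskOn_bit (Finset.univ.erase h) p h (by simp)
      rw [Finset.card_erase_of_mem (by simp)] at this
      exact Realizable.of_cost (by simpa using this)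
    have h2 : Realizable a b (mono f₂ fun _ => 1) c :=
      hc.pattern _ h (by rw [mem_low]; omega) y
    have h3 := h2.mul h1
    rw [mono_mul_mono] at h3
    have e1 : ∀ z, z h = false → f₁ z = z := by
      intro z hz
      funext i
      simp [hf₁, maskOn, hz]
    have e2 : f₁ x = update y h true := by
      funext i
      by_cases hi : i = h
      · subst hi; simp [hf₁, maskOn, hxh]
      · simp only [hf₁, maskOn, Finset.mem_erase, Finset.mem_univ, and_true, ne_eq, hi,
          not_false_eq_true, if_true, hxh, Bool.and_true, p, update_of_ne hi]
        cases x i <;> simp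
    have e3 : f₂ (f₁ x) = y := by
      rw [e2, hf₂, flipBit]
      have : matchOn (low (n + 1) s) y (update y h true) = true := by
        simp only [matchOn, decide_eq_true_eq]
        intro i hi
        rw [mem_low] at hi
        exact update_of_ne (by rintro rfl; omega) _ _
      rw [this, update_self, update_idem]
      simp [← hyh]
    have e4 : ∀ z ∈ T, InBlock s z → f₂ (f₁ z) = z := by
      intro z hzT hz
      rw [e1 z (hz h hsh), hf₂, flipBit]
      have : matchOn (low (n + 1) s) y z = false := by
        rw [← Bool.not_eq_true]
        simp only [matchOn, decide_eq_true_eq]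
        intro hm
        apply hyT
        convert hzT
        funext i
        by_cases hi : (i : ℕ) < s
        · exact (hm i (mem_low.2 hi)).symm
        · rw [hz i (by omega), hyB i (by omega)]
      rw [this]
      simp
    obtain ⟨g, hg, hgT⟩ := ih (T.image (f₂ ∘ f₁)) (Finset.card_image_le.trans hT)
      ((U.erase x).image (f₂ ∘ f₁))
      (Finset.image_subset_image ((Finset.erase_subset _ _).trans hUT))
      (Finset.card_image_le.trans (by rw [Finset.card_erase_of_mem hxU]; omega)) (by
        intro z hz hzU
        obtain ⟨z, hzT, rfl⟩ := Finset.mem_image.1 hz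
        by_cases hzx : z = x
        · subst hzx
          rw [Function.comp_apply, e3]
          exact hyB
        · have hzB := hU z hzT fun h => hzU (Finset.mem_image_of_mem _ (by simp [hzx, h]))
          rw [Function.comp_apply, e4 z hzT hzB]
          exact hzB)
    have h4 := hg.mul h3
    rw [mono_mul_mono] at h4
    refine ⟨g ∘ f₂ ∘ f₁, Realizable.le ?_ (show r * (n + c) + (c + n) ≤ (r + 1) * (n + c) by
      ring_nf; rfl), fun z hz => hgT _ (Finset.mem_image_of_mem _ hz)⟩
    simpa using h4

/-- A set of `k + 1 ≤ 2 ^ s` basis states is moved into the block of the first `s` qubits by `k`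
pivots. -/
theorem exists_pivot_block (hc : HasMcx a b (n + 1) c) (s : ℕ) (hs : s ≤ n + 1)
    (T : Finset (Fin (n + 1) → Bool)) (hT : T.Nonempty) (hTs : T.card ≤ 2 ^ s) :
    ∃ f : (Fin (n + 1) → Bool) → (Fin (n + 1) → Bool),
      Realizable a b (mono f fun _ => 1) ((T.card - 1) * (n + c)) ∧ ∀ x ∈ T, InBlock s (f x) := by
  classical
  obtain ⟨x, hx⟩ := hT
  -- Free NOT gates translate one state to `0`, which lies in the block; this saves one pivot.
  set f₁ := maskOn Finset.univ x fun _ => true with hf₁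
  have h1 : Realizable a b (mono f₁ fun _ => 1) 0 := Realizable.of_cost (cost_maskOn_true _ _)
  obtain ⟨g, hg, hgT⟩ := exists_pivot hc s hs (T.card - 1) (T.image f₁)
    (Finset.card_image_le.trans hTs) ((T.erase x).image f₁)
    (Finset.image_subset_image (Finset.erase_subset _ _))
    (Finset.card_image_le.trans (by rw [Finset.card_erase_of_mem hx])) (by
      intro z hz hzU
      obtain ⟨z, hzT, rfl⟩ := Finset.mem_image.1 hz
      obtain rfl : z = x := by
        by_contra h
        exact hzU (Finset.mem_image_of_mem _ (by simp [h, hzT]))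
      intro i _
      simp [hf₁, maskOn])
  have h4 := hg.mul h1
  rw [mono_mul_mono] at h4
  exact ⟨g ∘ f₁, by simpa using h4, fun z hz => hgT _ (Finset.mem_image_of_mem _ hz)⟩

/-- CNOTs from a bit `h` where `p` and `q` differ make them neighbours. A fully controlled NOT swaps
two neighbours, and the CNOTs are then undone. -/
theorem HasMcx.swap (hc : HasMcx a b (n + 1) c) (p q : Fin (n + 1) → Bool) :
    Realizable a b (mono (Equiv.swap p q) fun _ => 1) (2 * n + c) := by
  by_cases hpq : p = q
  · subst hpq
    rw [Equiv.swap_self]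
    exact (show mono (Equiv.refl (Fin (n + 1) → Bool)) (fun _ => (1 : ℂ)) = 1 from mono_id_one) ▸
      Realizable.one.le (Nat.zero_le _)
  obtain ⟨h, hh⟩ := Function.ne_iff.1 hpq
  wlog hp : p h = true generalizing p q
  · rw [Equiv.swap_comm]
    refine this q p (Ne.symm hpq) hh.symm ?_
    cases hq : q h <;> simp_all
  have hq : q h = false := by simpa [hp] using hh.symm
  set S : Finset (Fin (n + 1)) := Finset.univ.erase h
  set f₁ : Equiv.Perm (Fin (n + 1) → Bool) :=
    (maskOn_bit_involutive S (fun i => xor (p i) (q i)) h (by simp [S])).toPerm with hf₁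
  have h1 : Realizable a b (mono f₁ fun _ => 1) n := by
    have := cost_maskOn_bit S (fun i => xor (p i) (q i)) h (by simp [S])
    rw [Finset.card_erase_of_mem (by simp), Finset.card_univ, Fintype.card_fin,
      Nat.add_sub_cancel] at this
    exact Realizable.of_cost this
  have h2 := hc.pattern S h (by simp [S]) q
  have e2 : flipBit h (matchOn S q) = Equiv.swap q (update q h true) := by
    funext x
    by_cases hm : ∀ i ∈ S, x i = q i
    · have : matchOn S q x = true := by simpa [matchOn] using hm
      rw [flipBit, this]
      have hx : x = update q h (x h) := by
        funext i
        by_cases hi : i = h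
        · subst hi; simp
        · rw [update_of_ne hi]; exact hm i (by simp [S, hi])
      obtain h' | h' := Bool.eq_false_or_eq_true (x h)
      · rw [h'] at hx ⊢
        conv_rhs => rw [hx, Equiv.swap_apply_right]
        rw [hx]; simp [← hq]
      · rw [h'] at hx ⊢
        rw [← hq, update_eq_self] at hx
        conv_rhs => rw [hx, Equiv.swap_apply_left]
        rw [hx]; simp
    · have : matchOn S q x = false := by simpa [matchOn] using hm
      rw [flipBit, this, Equiv.swap_apply_of_ne_of_ne]
      · simp
      · rintro rfl; exact hm fun i _ => rfl
      · rintro rfl; exact hm fun i hi => update_of_ne (by rintro rfl; simp [S] at hi) _ _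
  rw [e2] at h2
  have h3 := (h1.mul h2).mul h1
  rw [mono_mul_mono, mono_mul_mono] at h3
  refine Realizable.le ?_ (show n + c + n ≤ 2 * n + c by omega)
  convert h3 using 1
  have e1 : ∀ x, f₁ x = maskOn S (fun i => xor (p i) (q i)) (fun x => x h) x := fun x => rfl
  have e3 : f₁ q = q := by
    rw [e1]; funext i; simp [maskOn, hq]
  have e4 : f₁ (update q h true) = p := by
    rw [e1]; funext i
    by_cases hi : i = h
    · subst hi; simp [maskOn, S, hp]
    · simp only [maskOn, S, Finset.mem_erase, Finset.mem_univ, and_true, ne_eq, hi,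
        not_false_eq_true, if_true, update_self, Bool.and_true, update_of_ne hi]
      cases q i <;> simp
  have e5 : f₁⁻¹ = f₁ := by
    rw [Equiv.Perm.inv_def, hf₁, Function.Involutive.toPerm_symm]
  have e6 := Equiv.swap_apply_apply f₁ q (update q h true)
  rw [e3, e4, e5, Equiv.swap_comm] at e6
  rw [e6]
  congr 1
  · simp

/-- Permuted diagonal isometries: `2 ^ m - 1` transpositions and a diagonal gate. -/
theorem HasMcx.permDiag (hc : HasMcx a b (n + 1) c) {m : ℕ} (hm : m ≤ n + 1)
    (σ : (Fin m → Bool) → (Fin (n + 1) → Bool)) (hσ : Function.Injective σ)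
    (φ : (Fin m → Bool) → ℂ) (hφ : ∀ x, ‖φ x‖ = 1) :
    ∃ A : Matrix (Fin (n + 1) → Bool) (Fin (n + 1) → Bool) ℂ,
      Realizable a b A ((2 ^ m - 1) * (2 * n + c) + (2 ^ m - 2)) ∧
      A * stdIsometry (n + 1) m = mono σ φ := by
  classical
  set x₀ : Fin m → Bool := fun _ => false
  -- The state `x₀` is placed by free NOT gates, each further one by a transposition. A
  -- transposition leaves the states already placed alone because `σ` and the map `f` built so far
  -- are injective.
  have key : ∀ X : Finset (Fin m → Bool), x₀ ∉ X →
      ∃ f : (Fin (n + 1) → Bool) → (Fin (n + 1) → Bool),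
        Realizable a b (mono f fun _ => 1) (X.card * (2 * n + c)) ∧
        ∀ x ∈ insert x₀ X, f (pad (n + 1) x) = σ x := by
    intro X
    induction X using Finset.induction_on with
    | empty =>
      intro _
      refine ⟨maskOn Finset.univ (fun i => xor (pad (n + 1) x₀ i) (σ x₀ i)) fun _ => true,
        by simpa using Realizable.of_cost (cost_maskOn_true _ _), ?_⟩
      intro x hx
      obtain rfl : x = x₀ := by simpa using hx
      funext i
      simp only [maskOn, Finset.mem_univ, if_true, Bool.and_true]
      cases pad (n + 1) x₀ i <;> simp
    | insert y X hy ih =>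
      intro h0
      simp only [Finset.mem_insert, not_or] at h0
      obtain ⟨f, hf, hfX⟩ := ih h0.2
      have h1 := (hc.swap (f (pad (n + 1) y)) (σ y)).mul hf
      rw [mono_mul_mono] at h1
      refine ⟨_, Realizable.le (c := (2 * n + c) + X.card * (2 * n + c)) (by simpa using h1)
        (by rw [Finset.card_insert_of_notMem hy]; ring_nf; rfl), ?_⟩
      intro x hx
      rw [Function.comp_apply]
      by_cases hxy : x = y
      · subst hxy; exact Equiv.swap_apply_left _ _
      · have hxX : x ∈ insert x₀ X := by
          simp only [Finset.mem_insert] at hx ⊢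
          tauto
        rw [Equiv.swap_apply_of_ne_of_ne]
        · exact hfX x hxX
        · exact fun h => hxy (pad_injective hm (hf.injective h))
        · rw [hfX x hxX]
          exact fun h => hxy (hσ h)
  obtain ⟨f, hf, hfX⟩ := key (Finset.univ.erase x₀) (by simp)
  rw [Finset.card_erase_of_mem (by simp)] at hf
  have hd := cost_diag (low (n + 1) m) (fun y => φ fun i => y (Fin.castLE hm i)) (fun _ => hφ _)
    (fun x y h => by
      have : (fun i : Fin m => x (Fin.castLE hm i)) = fun i => y (Fin.castLE hm i) := by
        funext i
        exact h _ (mem_low.2 (by simp))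
      simp only [this])
  refine ⟨_, Realizable.mul (c := (2 ^ m - 1) * (2 * n + c)) (c' := 2 ^ m - 2)
    (by simpa using hf) ((Realizable.of_cost hd).le (Nat.sub_le_sub_right
      (Nat.pow_le_pow_right (by norm_num) (card_low_le _ _)) _)), ?_⟩
  have e : stdIsometry (n + 1) m = mono (pad (n + 1)) fun _ => 1 := rfl
  rw [e, mono_mul_mono, mono_mul_mono]
  congr 1
  · funext x; exact hfX x (by simp)
  · funext x
    have : (fun i : Fin m => pad (n + 1) x (Fin.castLE hm i)) = x := by
      funext i; simp [pad]
    simp [this]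

end

/-! ### Householder reflections -/

section Householder

theorem star_dotProduct_self {ι : Type} [Fintype ι] (v : ι → ℂ) :
    star v ⬝ᵥ v = ((∑ x, ‖v x‖ ^ 2 : ℝ) : ℂ) := by
  simp only [dotProduct, Pi.star_apply, Complex.star_def, Complex.ofReal_sum, Complex.ofReal_pow]
  exact Finset.sum_congr rfl fun x _ => by rw [mul_comm, Complex.mul_conj']

theorem star_dotProduct_self_eq_one_iff {ι : Type} [Fintype ι] (v : ι → ℂ) :
    star v ⬝ᵥ v = 1 ↔ ∑ x, ‖v x‖ ^ 2 = 1 := by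
  rw [star_dotProduct_self]; norm_cast

variable {n : ℕ}

theorem householder_mulVec (v u : (Fin n → Bool) → ℂ) :
    householder v *ᵥ u = u - (2 * (star v ⬝ᵥ u)) • v := by
  rw [householder, Matrix.sub_mulVec, Matrix.one_mulVec, Matrix.smul_mulVec,
    Matrix.vecMulVec_mulVec]
  congr 1
  ext y
  simp only [Pi.smul_apply, MulOpposite.smul_eq_mul_unop, MulOpposite.unop_op, smul_eq_mul]
  ring

/-- Covariance of reflections. It reduces a reflection to a simpler vector, and it also moves
monomial errors past later reflections. -/
theorem householder_mul {A : Matrix (Fin n → Bool) (Fin n → Bool) ℂ} (hA : Aᴴ * A = 1)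
    (v : (Fin n → Bool) → ℂ) : householder (A *ᵥ v) * A = A * householder v := by
  rw [householder, householder, Matrix.sub_mul, Matrix.mul_sub, Matrix.smul_mul, Matrix.mul_smul,
    Matrix.vecMulVec_mul, Matrix.mul_vecMulVec, Matrix.star_mulVec, Matrix.vecMul_vecMul, hA,
    Matrix.vecMul_one, Matrix.one_mul, Matrix.mul_one]

theorem star_dotProduct_mulVec {A : Matrix (Fin n → Bool) (Fin n → Bool) ℂ} (hA : Aᴴ * A = 1)
    (v : (Fin n → Bool) → ℂ) : star (A *ᵥ v) ⬝ᵥ (A *ᵥ v) = star v ⬝ᵥ v := by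
  rw [Matrix.star_mulVec, Matrix.dotProduct_mulVec, Matrix.vecMul_vecMul, hA, Matrix.vecMul_one]

/-- The normalized difference of two vectors. -/
noncomputable def reflector (e w : (Fin n → Bool) → ℂ) : (Fin n → Bool) → ℂ :=
  (((√2 : ℝ) : ℂ) / 2) • (e - w)

/-- The factor `2` of the reflection cancels the square of the normalization. For orthonormal `e`
and `w` this visibly swaps them and fixes every vector orthogonal to both. -/
theorem householder_reflector_mulVec (e w u : (Fin n → Bool) → ℂ) :
    householder (reflector e w) *ᵥ u = u - (star e ⬝ᵥ u - star w ⬝ᵥ u) • (e - w) := by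
  have h := sqrt_two_div_two_mul_self
  have hs : star (((√2 : ℝ) : ℂ) / 2) = ((√2 : ℝ) : ℂ) / 2 := by
    simp
  rw [householder_mulVec, reflector, star_smul, hs, star_sub, smul_dotProduct, sub_dotProduct,
    smul_smul, smul_eq_mul]
  congr 2
  linear_combination (2 * (star e ⬝ᵥ u - star w ⬝ᵥ u)) * h

theorem star_dotProduct_reflector {e w : (Fin n → Bool) → ℂ} (he : star e ⬝ᵥ e = 1)
    (hw : star w ⬝ᵥ w = 1) (hew : star e ⬝ᵥ w = 0) (hwe : star w ⬝ᵥ e = 0) :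
    star (reflector e w) ⬝ᵥ reflector e w = 1 := by
  have h := sqrt_two_div_two_mul_self
  have hs : star (((√2 : ℝ) : ℂ) / 2) = ((√2 : ℝ) : ℂ) / 2 := by
    simp
  rw [reflector, star_smul, hs, star_sub, smul_dotProduct, sub_dotProduct, dotProduct_smul,
    dotProduct_smul, dotProduct_sub, dotProduct_sub, he, hw, hew, hwe]
  simp only [smul_eq_mul]
  linear_combination 2 * h

theorem mono_mulVec_apply {f : (Fin n → Bool) → (Fin n → Bool)} (hf : Function.Injective f)
    (ψ v : (Fin n → Bool) → ℂ) (x : Fin n → Bool) : (mono f ψ *ᵥ v) (f x) = ψ x * v x := by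
  rw [Matrix.mulVec, dotProduct, Finset.sum_eq_single x]
  · simp [mono]
  · intro z _ hz
    simp [mono, hf.ne hz.symm]
  · simp

theorem mono_mulVec_ne_zero {f : (Fin n → Bool) → (Fin n → Bool)} {ψ v : (Fin n → Bool) → ℂ}
    {y : Fin n → Bool} (h : (mono f ψ *ᵥ v) y ≠ 0) : ∃ x, y = f x ∧ v x ≠ 0 := by
  obtain ⟨x, -, hx⟩ := Finset.exists_ne_zero_of_sum_ne_zero h
  refine ⟨x, ?_, right_ne_zero_of_mul hx⟩
  by_contra hy
  simp [mono, hy] at hx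

theorem nnz_mono_mulVec_le (f : (Fin n → Bool) → (Fin n → Bool)) (ψ v : (Fin n → Bool) → ℂ) :
    nnz (mono f ψ *ᵥ v) ≤ nnz v := by
  classical
  rw [nnz, nnz]
  refine (Finset.card_le_card ?_).trans (Finset.card_image_le (f := f))
  intro y hy
  obtain ⟨x, rfl, hx⟩ := mono_mulVec_ne_zero (Finset.mem_filter.1 hy).2
  exact Finset.mem_image_of_mem _ (by simpa using hx)

theorem mono_conjTranspose_mul {f : (Fin n → Bool) → (Fin n → Bool)} (hf : Function.Injective f)
    {ψ : (Fin n → Bool) → ℂ} (hψ : ∀ x, ‖ψ x‖ = 1) : (mono f ψ)ᴴ * mono f ψ = 1 := by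
  ext y x
  rw [mul_mono_apply, Matrix.conjTranspose_apply, mono, Matrix.of_apply, Matrix.one_apply]
  by_cases h : y = x
  · subst h
    rw [if_pos rfl, if_pos rfl, Complex.star_def, mul_comm, Complex.mul_conj', hψ]
    norm_num
  · rw [if_neg (hf.ne (Ne.symm h)), if_neg h, star_zero, zero_mul]

/-- By minimality of the logarithm, half of the power is less than `r`, hence at most `k`. -/
theorem two_pow_clog_sub_two_le {r k : ℕ} (h : r ≤ k + 1) : 2 ^ Nat.clog 2 r - 2 ≤ 2 * (k - 1) := by
  obtain h1 | h1 := Nat.lt_or_ge 1 r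
  · have h2 := Nat.pow_pred_clog_lt_self (b := 2) (by norm_num) h1
    have h3 : 0 < Nat.clog 2 r := Nat.clog_pos (by norm_num) h1
    have h4 : 2 ^ Nat.clog 2 r = 2 * 2 ^ (Nat.clog 2 r).pred := by
      rw [← pow_succ', Nat.pred_eq_sub_one, Nat.sub_add_cancel h3]
    omega
  · rw [Nat.clog_of_right_le_one h1]; simp

/-- A Householder reflection, up to a diagonal and a permutation gate: the support is moved into a
block, the phases are removed, and the reflection of the resulting state is conjugate to a
multi-controlled `Z` gate by a state preparation. -/
theorem HasMcx.householder {a b c : ℕ} (hc : HasMcx a b (n + 1) c) (k : ℕ)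
    (v : (Fin (n + 1) → Bool) → ℂ) (hv : star v ⬝ᵥ v = 1) (hk : nnz v ≤ 1 + k) :
    ∃ f ψ, Function.Injective f ∧ (∀ x, ‖ψ x‖ = 1) ∧
      Realizable a b (mono f ψ * SparseIsometry.householder v) (k * (n + c) + 6 * (k - 1) + c) := by
  set T : Finset (Fin (n + 1) → Bool) := Finset.univ.filter fun x => v x ≠ 0 with hTdef
  set s := Nat.clog 2 T.card with hs
  have hTk : T.card ≤ k + 1 := by rw [add_comm k]; exact hk
  have hT : T.Nonempty := by
    rw [Finset.nonempty_iff_ne_empty]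
    intro hT
    have h0 : v = 0 := by
      funext x
      by_contra hx
      have : x ∈ T := by simpa [hTdef] using hx
      simp [hT] at this
    simp [h0] at hv
  have hsn : s ≤ n + 1 := Nat.clog_le_of_le_pow (by simpa using T.card_le_univ)
  obtain ⟨f, hf, hfT⟩ := exists_pivot_block hc s hsn T hT (Nat.le_pow_clog (by norm_num) _)
  have hfi := hf.injective
  set v' := mono f (fun _ => 1) *ᵥ v with hv'
  have hB : ∀ y, v' y ≠ 0 → InBlock s y := by
    intro y hy
    obtain ⟨x, rfl, hx⟩ := mono_mulVec_ne_zero hy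
    exact hfT x (by simpa [hTdef] using hx)
  -- The phase correction is read from the first `s` bits only, so that its diagonal gate costs at
  -- most `2 ^ s - 2`; on the block, which contains the support, it is the right one.
  set pr : (Fin (n + 1) → Bool) → (Fin (n + 1) → Bool) := fun y i => if (i : ℕ) < s then y i else false
    with hpr
  have hprB : ∀ y, InBlock s y → pr y = y := by
    intro y hy
    funext i
    by_cases hi : (i : ℕ) < s
    · simp [hpr, hi]
    · simp [hpr, hi, hy i (by omega)]
  set φ : (Fin (n + 1) → Bool) → ℂ := fun y =>
    if v' (pr y) = 0 then 1 else star (v' (pr y)) / ‖v' (pr y)‖ with hφ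
  have hφ1 : ∀ y, ‖φ y‖ = 1 := by
    intro y
    by_cases h : v' (pr y) = 0
    · simp [hφ, h]
    · simp [hφ, h]
  have hD := cost_diag (low (n + 1) s) φ hφ1 (fun x y h => by
    have : pr x = pr y := by
      funext i
      by_cases hi : (i : ℕ) < s
      · simp [hpr, hi, h i (mem_low.2 hi)]
      · simp [hpr, hi]
    simp only [hφ, this])
  have hA := (Realizable.of_cost (a := a) (b := b) hD).mul hf
  rw [mono_mul_mono] at hA
  simp only [Function.id_comp, mul_one] at hA
  set A := mono f fun x => φ (f x) with hAdef
  have hAv : A *ᵥ v = fun y => ((‖v' y‖ : ℝ) : ℂ) := by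
    have hbij := Finite.injective_iff_bijective.1 hfi
    funext y
    obtain ⟨x, rfl⟩ := hbij.2 y
    have e : v' (f x) = v x := by rw [hv', mono_mulVec_apply hfi, one_mul]
    rw [hAdef, mono_mulVec_apply hfi, e]
    by_cases hx : v x = 0
    · simp [hx]
    · have h1 : pr (f x) = f x := hprB _ (hB _ (by rwa [e]))
      have h2 : ((‖v x‖ : ℝ) : ℂ) ≠ 0 := by simpa using hx
      simp only [hφ, h1, e, hx, if_false]
      rw [Complex.star_def, div_mul_eq_mul_div, mul_comm, Complex.mul_conj']
      field_simp
  obtain ⟨V, hV, hVu⟩ := cost_statePrep (low (n + 1) s) (fun y => ‖v' y‖) (fun _ => norm_nonneg _)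
    (by
      intro x q hq hxq
      by_contra h
      rw [norm_eq_zero] at h
      rw [mem_low, not_lt] at hq
      rw [hB x h q hq] at hxq
      exact Bool.false_ne_true hxq) (by
      rw [← star_dotProduct_self_eq_one_iff, hv', star_dotProduct_mulVec hf.conjTranspose_mul, hv])
  have hV0 : V *ᵥ (Pi.single (fun _ => false) 1) = A *ᵥ v := by
    rw [hAv]
    funext y
    simp [hVu]
  have hR : mono id (fun x : Fin (n + 1) → Bool => if x = (fun _ => false) then (-1 : ℂ) else 1) =
      SparseIsometry.householder (Pi.single (fun _ => false) 1) := by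
    rw [mono_id]
    ext y x
    rw [SparseIsometry.householder, Matrix.sub_apply, Matrix.smul_apply, Matrix.vecMulVec_apply,
      Pi.star_apply, Matrix.one_apply, Matrix.diagonal_apply]
    by_cases hxy : y = x
    · subst hxy
      by_cases hy : y = fun _ => false
      · simp [hy]; norm_num
      · simp [hy]
    · by_cases hy : y = fun _ => false
      · have hx : x ≠ fun _ => false := fun h => hxy (hy.trans h.symm)
        simp [hxy, hx]
      · simp [hxy, hy]
  have hV' := Realizable.of_cost (a := a) (b := b) hV
  have hH := (hV'.mul hc.reflection).mul hV'.inv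
  -- As `V|0⟩ = A v`, the conjugated reflection is that of `A v`; multiplied by `A` it becomes `A`
  -- times the reflection of `v`. The preparation, its inverse and the diagonal gate are the three
  -- terms `2 (k - 1)`.
  rw [hR, ← householder_mul hV'.conjTranspose_mul, hV0, Matrix.mul_assoc, hV'.mul_conjTranspose,
    Matrix.mul_one] at hH
  have hfin := hH.mul hA
  rw [householder_mul hA.conjTranspose_mul] at hfin
  refine ⟨f, fun x => φ (f x), hfi, fun x => hφ1 _, hfin.le ?_⟩
  have h1 : 2 ^ (low (n + 1) s).card - 2 ≤ 2 * (k - 1) :=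
    (Nat.sub_le_sub_right (Nat.pow_le_pow_right (by norm_num) (card_low_le _ _)) _).trans
      (two_pow_clog_sub_two_le hTk)
  have h2 : (T.card - 1) * (n + c) ≤ k * (n + c) := Nat.mul_le_mul_right _ (by omega)
  omega

end Householder

/-! ### Decomposition of an isometry -/

section Decomposition

variable {n m a b : ℕ}

/-- A family of Householder reflections maps the orthonormal system `w` to the orthonormal system
`e`. -/
theorem exists_householder_product {N : ℕ} {ι : Type} [DecidableEq ι]
    (e w : ι → (Fin N → Bool) → ℂ)
    (hee : ∀ x y, star (e x) ⬝ᵥ e y = if x = y then 1 else 0)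
    (hww : ∀ x y, star (w x) ⬝ᵥ w y = if x = y then 1 else 0)
    (hew : ∀ x y, star (e x) ⬝ᵥ w y = 0) (hwe : ∀ x y, star (w x) ⬝ᵥ e y = 0) (cost : ι → ℕ)
    (hcost : ∀ x, ∀ v : (Fin N → Bool) → ℂ, star v ⬝ᵥ v = 1 → nnz v ≤ nnz (reflector (e x) (w x)) →
      ∃ f ψ, Function.Injective f ∧ (∀ x, ‖ψ x‖ = 1) ∧
        Realizable a b (mono f ψ * householder v) (cost x)) (X : Finset ι) :
    ∃ f ψ G, Function.Injective f ∧ (∀ x, ‖ψ x‖ = 1) ∧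
      Realizable a b (mono f ψ * G) (∑ x ∈ X, cost x) ∧ (∀ x ∈ X, G *ᵥ w x = e x) ∧
      ∀ x ∉ X, G *ᵥ w x = w x ∧ G *ᵥ e x = e x := by
  induction X using Finset.induction_on with
  | empty =>
    exact ⟨id, fun _ => 1, 1, Function.injective_id, fun _ => by simp, by
      rw [mono_id_one, Matrix.mul_one]; exact Realizable.one, by simp, by simp⟩
  | insert y X hy ih =>
    obtain ⟨f, ψ, G, hf, hψ, hG, hGX, hGX'⟩ := ih
    have hM := mono_conjTranspose_mul hf hψ
    set v := reflector (e y) (w y) with hv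
    have hv1 : star v ⬝ᵥ v = 1 := star_dotProduct_reflector (by simp [hee]) (by simp [hww])
      (hew _ _) (hwe _ _)
    -- The circuit so far yields `M * G` rather than `G`, so the next reflection is implemented for
    -- `M v`, which becomes that of `v` once `M` is moved to the left.
    obtain ⟨f', ψ', hf', hψ', h'⟩ := hcost y (mono f ψ *ᵥ v)
      (by rw [star_dotProduct_mulVec hM, hv1]) (nnz_mono_mulVec_le _ _ _)
    have h := h'.mul hG
    rw [Matrix.mul_assoc, ← Matrix.mul_assoc (householder _), householder_mul hM,
      Matrix.mul_assoc, ← Matrix.mul_assoc, mono_mul_mono] at h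
    have hH := fun u => householder_reflector_mulVec (e y) (w y) u
    refine ⟨f' ∘ f, fun x => ψ' (f x) * ψ x, householder v * G, hf'.comp hf,
      fun x => by rw [norm_mul, hψ', hψ, one_mul],
      by rwa [Finset.sum_insert hy], ?_, ?_⟩
    · intro x hx
      rw [← Matrix.mulVec_mulVec]
      by_cases hxy : x = y
      · subst hxy
        rw [(hGX' x hy).1, hv, hH]
        simp [hew, hww]
      · rw [hGX x ((Finset.mem_insert.1 hx).resolve_left hxy), hv, hH]
        simp [hwe, hee, Ne.symm hxy]
    · intro x hx
      rw [Finset.mem_insert, not_or] at hx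
      rw [← Matrix.mulVec_mulVec, ← Matrix.mulVec_mulVec, (hGX' x hx.2).1, (hGX' x hx.2).2, hv, hH,
        hH]
      constructor
      · simp [hew, hww, Ne.symm hx.1]
      · simp [hwe, hee, Ne.symm hx.1]

/-- The matrix with an additional output qubit in the state `|0⟩`. -/
def extend (W : Matrix (Fin n → Bool) (Fin m → Bool) ℂ) :
    Matrix (Fin (n + 1) → Bool) (Fin m → Bool) ℂ :=
  Matrix.of fun y x => if y (Fin.last n) then 0 else W (Fin.init y) x

/-- The basis state `x` followed by zeros and a one on the additional qubit. -/
def marked (n : ℕ) (x : Fin m → Bool) : Fin (n + 1) → Bool :=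
  Fin.snoc (α := fun _ => Bool) (pad n x) true

theorem sum_snoc (g : (Fin (n + 1) → Bool) → ℂ) :
    ∑ y, g y = (∑ y : Fin n → Bool, g (Fin.snoc (α := fun _ => Bool) y false)) +
      ∑ y : Fin n → Bool, g (Fin.snoc (α := fun _ => Bool) y true) := by
  rw [← (Fin.snocEquiv fun _ => Bool).sum_comp, Fintype.sum_prod_type, Fintype.sum_bool, add_comm]
  rfl

theorem extend_snoc (W : Matrix (Fin n → Bool) (Fin m → Bool) ℂ) (y : Fin n → Bool) (v : Bool)
    (x : Fin m → Bool) :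
    extend W (Fin.snoc (α := fun _ => Bool) y v) x = if v then 0 else W y x := by
  simp [extend]

/-- An isometry is injective, so `2 ^ m ≤ 2 ^ n` by dimension. -/
theorem isometry_le {W : Matrix (Fin n → Bool) (Fin m → Bool) ℂ} (hW : IsIsometry W) : m ≤ n := by
  have h : Function.Injective (Matrix.mulVecLin W) := by
    intro u v huv
    have := congrArg (fun u => Wᴴ *ᵥ u) huv
    simpa [Matrix.mulVec_mulVec, show Wᴴ * W = 1 from hW] using this
  have := LinearMap.finrank_le_finrank_of_injective h
  simp only [Module.finrank_fintype_fun_eq_card, Fintype.card_fun, Fintype.card_bool,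
    Fintype.card_fin] at this
  exact (Nat.pow_le_pow_iff_right (by norm_num)).1 this

theorem marked_injective (h : m ≤ n) : Function.Injective (marked n : (Fin m → Bool) → _) := by
  intro x y hxy
  have := congrArg (Fin.init (α := fun _ => Bool)) hxy
  simp only [marked, Fin.init_snoc] at this
  exact pad_injective h this

/-- The vector `|x⟩` on the marked basis states. -/
noncomputable def markedVec (n : ℕ) (x : Fin m → Bool) : (Fin (n + 1) → Bool) → ℂ :=
  Pi.single (marked n x) 1

theorem nnz_reflector_le (W : Matrix (Fin n → Bool) (Fin m → Bool) ℂ) (x : Fin m → Bool) :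
    nnz (reflector (markedVec n x) fun y => extend W y x) ≤ 1 + nnz fun y => W y x := by
  classical
  rw [nnz, nnz, Nat.add_comm 1]
  refine (Finset.card_le_card (t := insert (marked n x)
    ((Finset.univ.filter fun y => W y x ≠ 0).image fun y =>
      (Fin.snoc (α := fun _ => Bool) y false : Fin (n + 1) → Bool))) ?_).trans
    ((Finset.card_insert_le _ _).trans (Nat.add_le_add_right Finset.card_image_le 1))
  intro y hy
  rw [Finset.mem_insert]
  by_cases hyx : y = marked n x
  · exact .inl hyx
  · right
    have h1 : extend W y x ≠ 0 := by
      intro h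
      apply (Finset.mem_filter.1 hy).2
      simp [reflector, markedVec, h, hyx]
    rw [← Fin.snoc_init_self y, extend_snoc] at h1
    refine Finset.mem_image.2 ⟨Fin.init y, ?_, ?_⟩
    · rw [Finset.mem_filter]
      exact ⟨Finset.mem_univ _, fun h => h1 (by simp [h])⟩
    · cases hl : y (Fin.last n)
      · rw [← hl]; exact Fin.snoc_init_self y
      · simp [hl] at h1

theorem star_extend_dotProduct {W : Matrix (Fin n → Bool) (Fin m → Bool) ℂ} (hW : IsIsometry W)
    (x y : Fin m → Bool) :
    star (fun z => extend W z x) ⬝ᵥ (fun z => extend W z y) = if x = y then 1 else 0 := by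
  rw [dotProduct, sum_snoc]
  simp only [Pi.star_apply, extend_snoc]
  have := congrFun (congrFun hW x) y
  rw [Matrix.mul_apply, Matrix.one_apply] at this
  simpa [Matrix.conjTranspose_apply] using this

/-- The decomposition of an isometry into Householder reflections and a permuted diagonal
isometry. -/
theorem exists_implements_extend {W : Matrix (Fin n → Bool) (Fin m → Bool) ℂ} (hW : IsIsometry W)
    (cost : (Fin m → Bool) → ℕ) (g : ℕ)
    (hcost : ∀ x, ∀ v : (Fin (n + 1) → Bool) → ℂ, star v ⬝ᵥ v = 1 →
      nnz v ≤ 1 + nnz (fun y => W y x) →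
      ∃ f ψ, Function.Injective f ∧ (∀ x, ‖ψ x‖ = 1) ∧
        Realizable a b (mono f ψ * householder v) (cost x))
    (hg : ∀ (σ : (Fin m → Bool) → (Fin (n + 1) → Bool)) (φ : (Fin m → Bool) → ℂ),
      Function.Injective σ → (∀ x, ‖φ x‖ = 1) →
      ∃ C : Circuit (Register (n + 1) a b), Implements C (mono σ φ) ∧ C.cnotCount ≤ g) :
    ∃ C : Circuit (Register (n + 1) a b),
      Implements C (extend W) ∧ C.cnotCount ≤ ∑ x, cost x + g := by
  have hmn := isometry_le hW
  have hmi := marked_injective hmn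
  have hne : ∀ x y : Fin m → Bool, extend W (marked n x) y = 0 := by
    intro x y; rw [marked, extend_snoc]; simp
  obtain ⟨f, ψ, G, hf, hψ, hG, hGw, -⟩ := exists_householder_product (markedVec n)
    (fun x y => extend W y x) (by
      intro x y
      by_cases hxy : x = y
      · simp [markedVec, hxy]
      · simp [markedVec, hxy, hmi.ne hxy])
    (star_extend_dotProduct hW) (by intro x y; simp [markedVec, hne])
    (by intro x y; simp [markedVec, hne]) cost
    (fun x v hv hk => hcost x v hv (hk.trans (nnz_reflector_le W x))) Finset.univ
  -- After `M * G` the columns of `W` have become `M (e x)`, basis states with phases, that is, a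
  -- permuted diagonal isometry.
  obtain ⟨C, hC, hCg⟩ := hg (f ∘ marked n) (ψ ∘ marked n) (hf.comp hmi) fun x => hψ _
  have hprod : mono f ψ * G * extend W = mono (f ∘ marked n) (ψ ∘ marked n) := by
    ext y x
    have h1 : G *ᵥ (fun y => extend W y x) = markedVec n x := hGw x (Finset.mem_univ _)
    have h2 : (mono f ψ * G * extend W) y x = ((mono f ψ * G) *ᵥ fun y => extend W y x) y := rfl
    rw [h2, ← Matrix.mulVec_mulVec, h1, markedVec, Matrix.mulVec_single_one]
    rfl
  obtain ⟨D, hD, hDc⟩ := hG.inv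
  refine ⟨C ++ D, ?_, by rw [Circuit.cnotCount_append]; omega⟩
  rw [implements_iff] at hC ⊢
  intro d
  rw [Circuit.toMatrix_append, Matrix.mul_assoc, Matrix.mul_assoc, ← Matrix.mul_assoc C.toMatrix,
    hC, ← Matrix.mul_assoc, hD, Matrix.mul_assoc, ← hprod, ← Matrix.mul_assoc _ _ (extend W),
    hG.conjTranspose_mul, Matrix.one_mul]

end Decomposition

/-! ### The additional qubit as a clean ancilla -/

section Relabel

theorem toMatrix_map_equiv {Q Q' : Type} [Fintype Q] [DecidableEq Q] [Fintype Q'] [DecidableEq Q']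
    (ρ : Q ≃ Q') (C : Circuit Q) (w w' : Q' → Bool) :
    Circuit.toMatrix (List.map (Gate.map ρ.toEmbedding) C) w w' = C.toMatrix (w ∘ ρ) (w' ∘ ρ) := by
  have hmux : ∀ (q : Q) (U : (Q → Bool) → Matrix Bool Bool ℂ) (y x : Q' → Bool),
      mux (ρ q) (fun x => U (x ∘ ρ)) y x = mux q U (y ∘ ρ) (x ∘ ρ) := by
    intro q U y x
    have : update (x ∘ ρ) q (y (ρ q)) = update x (ρ q) (y (ρ q)) ∘ ρ := by
      rw [Function.update_comp_equiv]; simp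
    simp only [mux, Matrix.of_apply, Function.comp_apply, this,
      ρ.surjective.injective_comp_right.eq_iff]
  induction C generalizing w w' with
  | nil =>
    simp only [List.map_nil, Circuit.toMatrix, Matrix.one_apply,
      ρ.surjective.injective_comp_right.eq_iff]
  | cons g gs ih =>
    have hg : ∀ y x, (Gate.map ρ.toEmbedding g).toMatrix y x = g.toMatrix (y ∘ ρ) (x ∘ ρ) := by
      intro y x
      cases g with
      | single q U => exact hmux q (fun _ => U.1) y x
      | cnot c t h =>
        rw [Gate.map, Gate.toMatrix_cnot, Gate.toMatrix_cnot]
        exact hmux t (fun x => notPow (x c)) y x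
    rw [List.map_cons, Circuit.toMatrix, Circuit.toMatrix, Matrix.mul_apply, Matrix.mul_apply]
    simp only [ih, hg]
    exact (Equiv.arrowCongr ρ.symm (Equiv.refl Bool)).sum_comp
      fun z => Circuit.toMatrix gs (w ∘ ρ) z * g.toMatrix z (w' ∘ ρ)

/-- The last qubit of the register becomes the first clean ancilla. -/
def relabel (n a b : ℕ) : Register (n + 1) a b ≃ Register n (a + 1) b :=
  (Equiv.sumCongr (finSumFinEquiv (m := n) (n := 1)).symm (Equiv.refl _)).trans <|
    (Equiv.sumAssoc _ _ _).trans <| Equiv.sumCongr (Equiv.refl _) <|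
      (Equiv.sumAssoc _ _ _).symm.trans <| Equiv.sumCongr
        (finSumFinEquiv.trans (finCongr (Nat.add_comm 1 a))) (Equiv.refl _)

theorem basisState_comp_relabel {n a b : ℕ} (y : Fin n → Bool) (z : Fin (a + 1) → Bool)
    (e : Fin b → Bool) : basisState y z e ∘ relabel n a b =
      basisState (Fin.snoc (α := fun _ => Bool) y (z 0)) (fun i => z i.succ) e := by
  funext i
  rcases i with i | i | i
  · refine Fin.lastCases ?_ (fun i => ?_) i
    · simp [basisState, relabel, Fin.snoc_last]
      rfl
    · simp [basisState, relabel]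
  · simp [basisState, relabel]
  · simp [basisState, relabel]

theorem snoc_pad {n m : ℕ} (h : m ≤ n) (x : Fin m → Bool) :
    (Fin.snoc (α := fun _ => Bool) (pad n x) false : Fin (n + 1) → Bool) = pad (n + 1) x := by
  funext i
  refine Fin.lastCases ?_ (fun i => ?_) i
  · simp [pad, Nat.not_lt.2 h]
  · simp [pad]

theorem Implements.relabel {n m a b : ℕ} (hmn : m ≤ n)
    {W : Matrix (Fin n → Bool) (Fin m → Bool) ℂ} {C : Circuit (Register (n + 1) a b)}
    (hC : Implements C (extend W)) :
    Implements (List.map (Gate.map (relabel n a b).toEmbedding) C : Circuit _) W := by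
  intro x d y z e
  rw [toMatrix_map_equiv, basisState_comp_relabel, basisState_comp_relabel, snoc_pad hmn, hC,
    extend_snoc]
  have : z = (fun _ => false) ↔ z 0 = false ∧ (fun i : Fin a => z i.succ) = fun _ => false := by
    simp only [funext_iff, Fin.forall_fin_succ]
  by_cases h0 : z 0 = false
  · simp [this, h0]
  · simp [this, h0]

end Relabel

/-! ### The main results -/

section Main

variable {n m a b c : ℕ}

theorem nnz_eq_sum (W : Matrix (Fin n → Bool) (Fin m → Bool) ℂ) :
    nnz (fun p : (Fin n → Bool) × (Fin m → Bool) => W p.1 p.2) = ∑ x, nnz fun y => W y x := by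
  simp only [nnz, Finset.card_filter]
  exact Fintype.sum_prod_type_right' fun y x => if W y x ≠ 0 then 1 else 0

theorem one_le_nnz {W : Matrix (Fin n → Bool) (Fin m → Bool) ℂ} (hW : IsIsometry W)
    (x : Fin m → Bool) : 1 ≤ nnz fun y => W y x := by
  rw [Nat.one_le_iff_ne_zero, nnz, Ne, Finset.card_eq_zero, Finset.filter_eq_empty_iff]
  intro h
  have h1 := congrFun (congrFun hW x) x
  rw [Matrix.mul_apply, Matrix.one_apply_eq, Finset.sum_eq_zero] at h1
  · exact zero_ne_one h1
  · intro y hy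
    rw [not_not.1 (h hy), mul_zero]

/-- The reflection for column `x` has `k = nnz (W|x⟩)` in `HasMcx.householder`; summing over the
columns gives `nnz W`, and `HasMcx.permDiag` gives the last term. -/
theorem exists_implements (hc : HasMcx a b (n + 1) c)
    {W : Matrix (Fin n → Bool) (Fin m → Bool) ℂ} (hW : IsIsometry W) :
    ∃ C : Circuit (Register n (a + 1) b), Implements C W ∧
      (C.cnotCount : ℤ) ≤ (n + c + 6) *
          (nnz fun p : (Fin n → Bool) × (Fin m → Bool) => W p.1 p.2) +
        (c - 6) * 2 ^ m + (2 ^ m - 1) * (2 * n + c + 1) := by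
  have hmn := isometry_le hW
  obtain ⟨C, hC, hCc⟩ := exists_implements_extend hW
    (fun x => (nnz fun y => W y x) * (n + c) + 6 * ((nnz fun y => W y x) - 1) + c)
    ((2 ^ m - 1) * (2 * n + c) + (2 ^ m - 2)) (fun x v hv hk => hc.householder _ v hv hk)
    fun σ φ hσ hφ => by
      obtain ⟨A, ⟨C, hC, hCc⟩, hAσ⟩ := hc.permDiag (hmn.trans (Nat.le_succ n)) σ hσ φ hφ
      refine ⟨C, (implements_iff _ _).2 fun d => ?_, hCc⟩
      rw [hC, Matrix.mul_assoc, hAσ]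
  refine ⟨_, hC.relabel hmn, ?_⟩
  rw [cnotCount_map]
  have h1 : (∑ x, ((nnz fun y => W y x) * (n + c) + 6 * ((nnz fun y => W y x) - 1) + c : ℕ) : ℤ) =
      (n + c + 6) * (nnz fun p : (Fin n → Bool) × (Fin m → Bool) => W p.1 p.2) +
        (c - 6) * 2 ^ m := by
    rw [nnz_eq_sum]
    have : ∀ x : Fin m → Bool,
        (((nnz fun y => W y x) * (n + c) + 6 * ((nnz fun y => W y x) - 1) + c : ℕ) : ℤ) =
          (n + c + 6) * ((nnz fun y => W y x : ℕ) : ℤ) + (c - 6) := by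
      intro x
      -- No column is zero, so the truncated subtraction is exact and contributes the `-6`.
      push_cast [one_le_nnz hW x]
      ring
    rw [Finset.sum_congr rfl fun x _ => this x, Finset.sum_add_distrib, ← Finset.mul_sum]
    simp only [Finset.sum_const, Finset.card_univ, Fintype.card_fun, Fintype.card_bool,
      Fintype.card_fin, nsmul_eq_mul]
    push_cast
    ring
  have h2 : (((2 ^ m - 1) * (2 * n + c) + (2 ^ m - 2) : ℕ) : ℤ) ≤
      (2 ^ m - 1) * (2 * n + c + 1) := by
    have h3 : 1 ≤ 2 ^ m := Nat.one_le_two_pow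
    calc (((2 ^ m - 1) * (2 * n + c) + (2 ^ m - 2) : ℕ) : ℤ)
        ≤ (((2 ^ m - 1) * (2 * n + c) + (2 ^ m - 1) : ℕ) : ℤ) := by
          exact_mod_cast Nat.add_le_add_left (by omega) _
      _ = _ := by push_cast [h3]; ring
  rw [← h1]
  refine le_trans ?_ (add_le_add_right h2 _)
  exact_mod_cast hCc

/-- Counts are integers: if every circuit exceeded `N`, the infimum would be at least `N + 1`. -/
theorem exists_of_minCNOT_le {S : Set (Matrix (Fin n → Bool) (Fin m → Bool) ℂ)} {N : ℕ}
    (h : minCNOT a b S ≤ N) :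
    ∃ C : Circuit (Register n a b), ∃ A ∈ S, Implements C A ∧ C.cnotCount ≤ N := by
  by_contra! hC
  have h1 : ((N + 1 : ℕ) : ℕ∞) ≤ minCNOT a b S := le_iInf₂ fun C ⟨A, hA, hCA⟩ => by
    exact_mod_cast hC C A hA hCA
  have := h1.trans h
  norm_cast at this
  omega

theorem permMatrix_eq_mono {α : Type} [DecidableEq α] (π : Equiv.Perm α) :
    π.permMatrix ℂ = mono π.symm fun _ => 1 := by
  ext y x
  simp [Equiv.Perm.permMatrix, PEquiv.toMatrix_apply, mono, Equiv.eq_symm_apply, eq_comm]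

theorem exists_realizable_of_householderCost_le {s N : ℕ} (h : householderCost a b n s ≤ N)
    (v : (Fin n → Bool) → ℂ) (hv : star v ⬝ᵥ v = 1) (hs : nnz v ≤ 2 ^ s) :
    ∃ f ψ, Function.Injective f ∧ (∀ x, ‖ψ x‖ = 1) ∧
      Realizable a b (mono f ψ * householder v) N := by
  rw [householderCost, iSup_le_iff] at h
  have h1 := h v
  rw [iSup_le_iff] at h1
  have h2 := h1 ((star_dotProduct_self_eq_one_iff v).1 hv)
  rw [iSup_le_iff] at h2
  obtain ⟨C, A, ⟨D, P, ⟨δ, hδ, rfl⟩, ⟨π, rfl⟩, rfl⟩, hC, hCN⟩ := exists_of_minCNOT_le (h2 hs)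
  refine ⟨π.symm, fun x => δ (π.symm x), π.symm.injective, fun x => hδ _, ?_⟩
  rw [permMatrix_eq_mono, ← mono_id, mono_mul_mono] at hC
  rw [realizable_iff]
  exact ⟨C, by simpa using hC, hCN⟩

theorem exists_implements_of_permDiagCost_le {N : ℕ} (hmn : m ≤ n) (h : permDiagCost a b n m ≤ N)
    (σ : (Fin m → Bool) → (Fin n → Bool)) (φ : (Fin m → Bool) → ℂ) (hσ : Function.Injective σ)
    (hφ : ∀ x, ‖φ x‖ = 1) :
    ∃ C : Circuit (Register n a b), Implements C (mono σ φ) ∧ C.cnotCount ≤ N := by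
  classical
  have hp := pad_injective (n := n) hmn
  set e := (Equiv.ofInjective _ hp).symm.trans (Equiv.ofInjective _ hσ)
  set τ : Equiv.Perm (Fin n → Bool) := e.extendSubtype with hτ
  have hτσ : ∀ x, τ (pad n x) = σ x := by
    intro x
    have := e.extendSubtype_apply_of_mem (pad n x) ⟨x, rfl⟩
    rw [hτ, this]
    have h2 : (⟨pad n x, ⟨x, rfl⟩⟩ : Set.range (pad n : (Fin m → Bool) → _)) =
      Equiv.ofInjective _ hp x := rfl
    simp only [e, Equiv.trans_apply]
    erw [h2, Equiv.symm_apply_apply]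
    rfl
  rw [permDiagCost, iSup_le_iff] at h
  -- `permMatrix` sends basis states along the inverse permutation, so `τ.symm` is needed to realize
  -- the extension `τ` of `σ`.
  have h1 := h (Equiv.Perm.permMatrix ℂ τ.symm)
  rw [iSup_le_iff] at h1
  have h2 := h1 (Matrix.diagonal φ)
  rw [iSup_le_iff] at h2
  have h3 := h2 ⟨_, rfl⟩
  rw [iSup_le_iff] at h3
  obtain ⟨C, A, hA, hC, hCN⟩ := exists_of_minCNOT_le (h3 ⟨φ, hφ, rfl⟩)
  rw [Set.mem_singleton_iff] at hA
  refine ⟨C, ?_, hCN⟩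
  convert hC using 1
  have e1 : stdIsometry n m = mono (pad n) fun _ => 1 := rfl
  rw [hA, permMatrix_eq_mono, e1, mono_mul_mono, ← mono_id, mono_mul_mono]
  congr 1
  · funext x; simp [hτσ]
  · simp

end Main

end SparseIsometry

theorem mainTheorem4 (n m : ℕ)
    (W : Matrix (Fin n → Bool) (Fin m → Bool) ℂ) (hW : SparseIsometry.IsIsometry W) :
    (∀ a b : ℕ, ∃ C : SparseIsometry.Circuit (SparseIsometry.Register n (a + 1) b),
      SparseIsometry.Implements C W ∧
      (C.cnotCount : ℕ∞) ≤
        (∑ x : Fin m → Bool, SparseIsometry.householderCost a b (n + 1)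
          (Nat.clog 2 (1 + SparseIsometry.nnz (fun y => W y x))))
        + SparseIsometry.permDiagCost a b (n + 1) m) ∧
    (∃ C : SparseIsometry.Circuit (SparseIsometry.Register n 1 1),
      SparseIsometry.Implements C W ∧
      (C.cnotCount : ℤ) ≤
        (17 * n + 12) * (SparseIsometry.nnz (fun p : (Fin n → Bool) × (Fin m → Bool) => W p.1 p.2))
        + (34 * n + 34 * m - 5) * 2 ^ m) ∧
    (1 ≤ n → ∃ C : SparseIsometry.Circuit (SparseIsometry.Register n ⌈(n : ℚ) / 2⌉₊ 0),
      SparseIsometry.Implements C W ∧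
      (C.cnotCount : ℤ) ≤
        (7 * n + 4) * (SparseIsometry.nnz (fun p : (Fin n → Bool) × (Fin m → Bool) => W p.1 p.2))
        + (14 * n + 24 * m - 21) * 2 ^ m) := by
  open SparseIsometry in
  have hmn := isometry_le hW
  have hM : (1 : ℤ) ≤ 2 ^ m := by exact_mod_cast Nat.one_le_two_pow
  have hK : (2 ^ m : ℤ) ≤ (nnz fun p : (Fin n → Bool) × (Fin m → Bool) => W p.1 p.2 : ℕ) := by
    rw [nnz_eq_sum]
    have := Finset.card_nsmul_le_sum Finset.univ (fun x : Fin m → Bool => nnz fun y => W y x) 1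
      fun x _ => one_le_nnz hW x
    simp only [Finset.card_univ, Fintype.card_fun, Fintype.card_bool, Fintype.card_fin, smul_eq_mul,
      mul_one] at this
    exact_mod_cast this
  refine ⟨fun a b => ?_, ?_, fun hn => ?_⟩
  -- If some cost is infinite the bound is trivial, but a circuit must still be exhibited.
  · by_cases hP : permDiagCost a b (n + 1) m = ⊤
    · obtain ⟨C, hC, -⟩ := exists_implements (hasMcx_pow a b (n + 1)) hW
      exact ⟨C, hC, by rw [hP]; simp⟩
    by_cases hH : ∃ x, householderCost a b (n + 1) (Nat.clog 2 (1 + nnz fun y => W y x)) = ⊤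
    · obtain ⟨C, hC, -⟩ := exists_implements (hasMcx_pow a b (n + 1)) hW
      refine ⟨C, hC, ?_⟩
      obtain ⟨x, hx⟩ := hH
      have : (⊤ : ℕ∞) ≤ ∑ x, householderCost a b (n + 1) (Nat.clog 2 (1 + nnz fun y => W y x)) := by
        rw [← hx]
        exact Finset.single_le_sum (f := fun x =>
          householderCost a b (n + 1) (Nat.clog 2 (1 + nnz fun y => W y x)))
          (fun _ _ => zero_le) (Finset.mem_univ x)
      rw [top_le_iff.1 this]
      simp
    push Not at hH
    obtain ⟨C, hC, hCc⟩ := exists_implements_extend hW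
      (fun x => (householderCost a b (n + 1) (Nat.clog 2 (1 + nnz fun y => W y x))).toNat)
      (permDiagCost a b (n + 1) m).toNat
      (fun x v hv hk => exists_realizable_of_householderCost_le
        (ENat.natCast_toNat (hH x)).ge v hv (hk.trans (Nat.le_pow_clog (by norm_num) _)))
      (exists_implements_of_permDiagCost_le (hmn.trans (Nat.le_succ n)) (ENat.natCast_toNat hP).ge)
    refine ⟨_, hC.relabel hmn, ?_⟩
    rw [cnotCount_map, ← ENat.natCast_toNat hP,
      ← Finset.sum_congr rfl fun x _ => ENat.natCast_toNat (hH x)]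
    exact_mod_cast hCc
  · obtain ⟨C, hC, hCc⟩ := exists_implements (hasMcx_one_dirty n) hW
    refine ⟨C, hC, hCc.trans ?_⟩
    push_cast
    have h1 : (0 : ℤ) ≤ m * 2 ^ m := by positivity
    nlinarith
  · obtain ⟨a, ha⟩ : ∃ a, ⌈(n : ℚ) / 2⌉₊ = a + 1 := by
      refine Nat.exists_eq_succ_of_ne_zero fun h => ?_
      rw [Nat.ceil_eq_zero] at h
      have : (1 : ℚ) ≤ n := by exact_mod_cast hn
      linarith
    rw [ha]
    -- One of the `⌈n / 2⌉` clean ancillas is the marker; the other `a` serve the ladders.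
    have hna : n ≤ 2 * a + 2 := by
      have h1 := Nat.le_ceil ((n : ℚ) / 2)
      rw [ha] at h1
      push_cast at h1
      have h2 : (n : ℚ) ≤ 2 * a + 2 := by linarith
      exact_mod_cast h2
    obtain ⟨C, hC, hCc⟩ := exists_implements (hasMcx_clean n a hn hna) hW
    refine ⟨C, hC, hCc.trans ?_⟩
    have h5 : 5 ≤ 6 * n := by omega
    push_cast [h5]
    have hn' : (1 : ℤ) ≤ n := by exact_mod_cast hn
    -- The claimed bound exceeds the proved one by `3 nnz W + (24 m - 6) 2 ^ m + 8 n - 4`. For `m =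
    -- 0` the middle term is negative, and `n ≥ 1` and `nnz W ≥ 1` make up for it.
    obtain rfl | hm := Nat.eq_zero_or_pos m
    · simp only [pow_zero] at hK ⊢
      push_cast
      nlinarith
    · have hm' : (1 : ℤ) ≤ m := by exact_mod_cast hm
      have h1 : (2 : ℤ) ^ m ≤ m * 2 ^ m := le_mul_of_one_le_left (by positivity) hm'
      nlinarith
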